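/- Theorem 1. Let $m$ risky assets be driven by an $m$-dimensional standard Brownian motion $\boldsymbol B$ with independent components. Let $T>0$, $r\in\mathbb R$, $\boldsymbol v\in\mathbb R^m$, let $\boldsymbol\sigma\in\mathbb R^{m\times m}$ be invertible, and put $\boldsymbol\Sigma=\boldsymbol\sigma\boldsymbol\sigma^\top$. There are $n$ agents; agent $j$ has initial wealth $x_j\in\mathbb R$, risk aversion $\alpha_j>0$ and influence coefficient $\theta_j\ge 0$. Let $\boldsymbol W=[w_{ji}]\in\mathbb R^{n\times n}$ satisfy $w_{ji}\ge 0$ and $\sum_i w_{ji}=1$. An admissible strategy is a deterministic square integrable function $\boldsymbol P:[0,T]\to\mathbb R^m$. Under the strategy $\boldsymbol P_j$ the wealth of agent $j$ solves $$dX_j(t)=rX_j(t)\,dt+\boldsymbol P_j^\top(t)\,[\boldsymbol v\,dt+\boldsymbol\sigma\,d\boldsymbol B(t)],\qquad X_j(0)=x_j .$$ Given a profile $(\boldsymbol P_1,\dots,\boldsymbol P_n)$ of admissible strategies, put $\boldsymbol Q_j(t)=\sum_i w_{ji}\boldsymbol P_i(t)$. The profile $(\boldsymbol P_j^*)_j$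 is called optimal if, for every $j$, $\boldsymbol P_j^*$ maximizes $$\mathbb E\big[-\alpha_j^{-1}e^{-\alpha_jX_j(T)}\big]-\frac{\theta_j}{2}\int_0^T e^{2r(T-t)}\,\|\boldsymbol P_j(t)-\boldsymbol Q_j^*(t)\|^2\,dt$$ over all admissible $\boldsymbol P_j$, where the average $\boldsymbol Q_j^*=\sum_i w_{ji}\boldsymbol P_i^*$ of the followees' optimal strategies is taken as given (held fixed). For an admissible profile $(\boldsymbol P_j^*)_j$ put $$\eta_j=\exp\Big[-\alpha_jx_je^{rT}-\alpha_j\int_0^Te^{r(T-t)}\boldsymbol v^\top\boldsymbol P_j^*(t)\,dt+\frac{\alpha_j^2}{2}\int_0^Te^{2r(T-t)}\boldsymbol P_j^{*\top}(t)\boldsymbol\Sigma\boldsymbol P_j^*(t)\,dt\Big],$$ $$\bar{\boldsymbol P}_j(t)=\alpha_j^{-1}\boldsymbol\Sigma^{-1}\boldsymbol v\,e^{r(t-T)},\qquad \boldsymbol Z_j=\big(\boldsymbol I_m+\alpha_j^{-1}\eta_j^{-1}\theta_j\boldsymbol\Sigma^{-1}\big)^{-1}.$$ Then the matrices $\boldsymbol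 I_m+\alpha_j^{-1}\eta_j^{-1}\theta_j\boldsymbol\Sigma^{-1}$ are invertible, so that $\boldsymbol Z_j$ is well defined, and the profile $(\boldsymbol P_j^*)_j$ is optimal if and only if, for every $j$ and almost every $t\in[0,T]$, $$\boldsymbol P_j^*(t)=\boldsymbol Z_j\bar{\boldsymbol P}_j(t)+(\boldsymbol I_m-\boldsymbol Z_j)\boldsymbol Q_j^*(t).$$ -/

import Mathlib

open MeasureTheory ProbabilityTheory Filter Topology Set
open scoped NNReal ENNReal Matrix

/-- An `m`-dimensional standard Brownian motion with independent components. -/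
structure IsStandardBrownian {Ω : Type*} [MeasurableSpace Ω] {m : ℕ}
    (B : Fin m → ℝ≥0 → Ω → ℝ) (μ : Measure Ω) : Prop where
  brownian : ∀ k, IsBrownianReal (B k) μ
  indep : iIndepFun (fun k ω (t : ℝ≥0) => B k t ω) μ

/-- A step function `∑ i, val i • 1_{(pts i, pts (i+1)]}` on `[0, ∞)`. -/
structure TimeStep where
  len : ℕ
  pts : Fin (len + 1) → ℝ≥0
  mono : Monotone pts
  val : Fin len → ℝ

/-- The step function as a function of time. -/
noncomputable def TimeStep.toFun (e : TimeStep) (s : ℝ) : ℝ :=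
  ∑ i : Fin e.len,
    (Ioc (e.pts i.castSucc : ℝ) (e.pts i.succ : ℝ)).indicator (fun _ => e.val i) s

/-- The elementary stochastic integral `∫_0^t e dβ` of a step function. -/
noncomputable def TimeStep.integral {Ω : Type*} (e : TimeStep) (β : ℝ≥0 → Ω → ℝ) (t : ℝ≥0)
    (ω : Ω) : ℝ :=
  ∑ i : Fin e.len, e.val i * (β (min (e.pts i.succ) t) ω - β (min (e.pts i.castSucc) t) ω)

/-- `Y` is (a version of) the stochastic integral `∫_0^t f(s) dβ(s)` of the deterministic
square integrable function `f`: the `L²(μ)`-limit of the elementary integrals of step functions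
that converge to `f` in `L²(0, t)`. -/
def IsWienerIntegral {Ω : Type*} [MeasurableSpace Ω] (β : ℝ≥0 → Ω → ℝ) (μ : Measure Ω)
    (f : ℝ → ℝ) (t : ℝ≥0) (Y : Ω → ℝ) : Prop :=
  MemLp f 2 (volume.restrict (Ioc 0 (t : ℝ))) ∧ MemLp Y 2 μ ∧
    ∃ e : ℕ → TimeStep,
      Tendsto (fun N => eLpNorm (fun s => (e N).toFun s - f s) 2
        (volume.restrict (Ioc 0 (t : ℝ)))) atTop (𝓝 0) ∧
      Tendsto (fun N => eLpNorm (fun ω => (e N).integral β t ω - Y ω) 2 μ) atTop (𝓝 0)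

/-- The data of the investment game with `m` risky assets and `n` agents. -/
structure InvestmentGame (m n : ℕ) where
  /-- investment horizon -/
  T : ℝ
  /-- interest rate -/
  r : ℝ
  /-- excess return rates -/
  v : Fin m → ℝ
  /-- volatility matrix -/
  σ : Matrix (Fin m) (Fin m) ℝ
  /-- influence matrix -/
  W : Matrix (Fin n) (Fin n) ℝ
  /-- risk aversion coefficients -/
  α : Fin n → ℝ
  /-- influence coefficients -/
  θ : Fin n → ℝ
  /-- initial wealths -/
  x : Fin n → ℝ
  T_pos : 0 < T
  σ_unit : IsUnit σ
  W_nonneg : ∀ j i, 0 ≤ W j i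
  W_row_sum : ∀ j, ∑ i, W j i = 1
  α_pos : ∀ j, 0 < α j
  θ_nonneg : ∀ j, 0 ≤ θ j

namespace InvestmentGame

variable {m n : ℕ} (G : InvestmentGame m n)

/-- The covariance matrix `Σ = σ σᵀ`. -/
def cov : Matrix (Fin m) (Fin m) ℝ := G.σ * G.σᵀ

/-- Admissible deterministic strategies: square integrable functions `[0, T] → ℝᵐ`. -/
def Admissible (p : ℝ → Fin m → ℝ) : Prop :=
  MemLp p 2 (volume.restrict (Icc 0 G.T))

/-- `X` is a wealth process of agent `j` under the strategy `p`, that is, a solution of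
`dX = r X dt + pᵀ (v dt + σ dB)`, `X(0) = x_j`, in integral form. The equation determines `X(t)`
almost surely for every `t`, hence the process up to modification; path continuity and
adaptedness of a modification are consequences and are not imposed. -/
structure IsWealth {Ω : Type*} [MeasurableSpace Ω] (B : Fin m → ℝ≥0 → Ω → ℝ) (μ : Measure Ω)
    (j : Fin n) (p : ℝ → Fin m → ℝ) (X : ℝ → Ω → ℝ) : Prop where
  measurable : AEMeasurable (Function.uncurry X) ((volume.restrict (Icc 0 G.T)).prod μ)
  integrable : ∀ᵐ ω ∂μ, IntegrableOn (fun s => X s ω) (Icc 0 G.T)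
  equation : ∀ t : ℝ≥0, (t : ℝ) ≤ G.T → ∃ Y : Fin m → Ω → ℝ,
    (∀ k, IsWienerIntegral (B k) μ (fun s => (p s ᵥ* G.σ) k) t (Y k)) ∧
    ∀ᵐ ω ∂μ, X t ω = G.x j + (∫ s in (0 : ℝ)..t, (G.r * X s ω + p s ⬝ᵥ G.v)) + ∑ k, Y k ω

/-- The exponential utility `φ_j`. -/
noncomputable def utility (j : Fin n) (y : ℝ) : ℝ := -(G.α j)⁻¹ * Real.exp (-G.α j * y)

/-- The average deviation `D(p, q)`. -/
noncomputable def deviation (p q : ℝ → Fin m → ℝ) : ℝ :=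
  (1 / 2) * ∫ t in (0 : ℝ)..G.T,
    Real.exp (2 * G.r * (G.T - t)) * ((p t - q t) ⬝ᵥ (p t - q t))

/-- The objective `E φ_j(X(T)) - θ_j D(p, q)`. -/
noncomputable def objective {Ω : Type*} [MeasurableSpace Ω] (μ : Measure Ω) (j : Fin n)
    (X : ℝ → Ω → ℝ) (p q : ℝ → Fin m → ℝ) : ℝ :=
  (∫ ω, G.utility j (X G.T ω) ∂μ) - G.θ j * G.deviation p q

/-- `p` maximizes the objective of agent `j` over the admissible strategies when the average
strategy `q` of the followees is given. Strategies whose utility is not integrable have expected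
utility `-∞` (the utility is negative) and do not compete. -/
def IsOptimalAgainst {Ω : Type*} [MeasurableSpace Ω] (B : Fin m → ℝ≥0 → Ω → ℝ) (μ : Measure Ω)
    (j : Fin n) (q p : ℝ → Fin m → ℝ) : Prop :=
  G.Admissible p ∧ ∃ X : ℝ → Ω → ℝ, G.IsWealth B μ j p X ∧
    Integrable (fun ω => G.utility j (X G.T ω)) μ ∧
    ∀ (p' : ℝ → Fin m → ℝ) (X' : ℝ → Ω → ℝ), G.Admissible p' → G.IsWealth B μ j p' X' →
      Integrable (fun ω => G.utility j (X' G.T ω)) μ →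
      G.objective μ j X' p' q ≤ G.objective μ j X p q

/-- The average strategy `Q_j = ∑ i, w_ji P_i` of the followees of agent `j`. -/
def followees (P : Fin n → ℝ → Fin m → ℝ) (j : Fin n) (t : ℝ) : Fin m → ℝ :=
  ∑ i, G.W j i • P i t

/-- `P` is a profile of optimal strategies: each `P j` is optimal for agent `j` given the average
`Q_j` of the strategies in the profile itself. -/
def IsOptimalProfile {Ω : Type*} [MeasurableSpace Ω] (B : Fin m → ℝ≥0 → Ω → ℝ) (μ : Measure Ω)
    (P : Fin n → ℝ → Fin m → ℝ) : Prop :=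
  ∀ j, G.IsOptimalAgainst B μ j (G.followees P j) (P j)

/-- The rational decision `α_j⁻¹ Σ⁻¹ v e^{r(t-T)}`. -/
noncomputable def rational (j : Fin n) (t : ℝ) : Fin m → ℝ :=
  ((G.α j)⁻¹ * Real.exp (G.r * (t - G.T))) • (G.cov⁻¹ *ᵥ G.v)

/-- The integral constant `η_j`, evaluated at the strategy `p`. -/
noncomputable def eta (j : Fin n) (p : ℝ → Fin m → ℝ) : ℝ :=
  Real.exp (-G.α j * G.x j * Real.exp (G.r * G.T)
    - G.α j * (∫ t in (0 : ℝ)..G.T, Real.exp (G.r * (G.T - t)) * (G.v ⬝ᵥ p t))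
    + (G.α j) ^ 2 / 2 *
      ∫ t in (0 : ℝ)..G.T, Real.exp (2 * G.r * (G.T - t)) * (p t ⬝ᵥ (G.cov *ᵥ p t)))

/-- The matrix `I + α_j⁻¹ η_j⁻¹ θ_j Σ⁻¹`. -/
noncomputable def opinionInv (j : Fin n) (p : ℝ → Fin m → ℝ) : Matrix (Fin m) (Fin m) ℝ :=
  1 + ((G.α j)⁻¹ * (G.eta j p)⁻¹ * G.θ j) • G.cov⁻¹

/-- The investment opinion `Z_j = (I + α_j⁻¹ η_j⁻¹ θ_j Σ⁻¹)⁻¹`. -/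
noncomputable def opinion (j : Fin n) (p : ℝ → Fin m → ℝ) : Matrix (Fin m) (Fin m) ℝ :=
  (G.opinionInv j p)⁻¹

end InvestmentGame

/-! For a deterministic strategy `p`, the linear wealth equation makes X(T) Gaussian: its mean is x
e^{rT} + ∫ e^{r(T-s)} vᵀp ds and its variance is ∫ e^{2r(T-s)} pᵀΣp ds. The Gaussian exponential
moment therefore gives expected utility -α⁻¹ η(p) (`IsWealth.integral_utility`), and agent j faces a
deterministic problem: maximize -α⁻¹ η(p) - θ D(p, q) with q fixed. Here η is the exponential of a
convex quadratic functional and D is a convex quadratic, so the payoff is concave. In the L² inner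
product with weight e^{2r(T-t)}, its gradient is η e^{r(t-T)} v - αη Σp - θ(p - q), and `p` is a
maximizer iff this vanishes almost everywhere (`payoff_le_iff`). Dividing by αηΣ and multiplying by
Z turns that equation into the stated one (`gradient_eq_zero_iff`).

The stochastic part has to work with weak notions. Wiener integrals are only L²-limits, and the
wealth equation is only known almost surely at each fixed time. The values of the Brownian motion
and the indicators 1_{(0,s]} have the same Gram matrix, so there is an isometry `wienerMap` of L²
integrands into L²(μ); its values are Gaussian because the Gaussian characteristic function survives
L²-limits. The wealth equation is then a Volterra equation, solved path by path with the help of a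
jointly measurable version of the noise. A stochastic Fubini argument (`wiener_version_compounded`)
identifies the compounded noise as the Wiener integral of the compounded integrand
(`IsWealth.terminal_ae_eq`). -/

/-! ### The Gaussian isometry attached to a Brownian motion -/

section GramIsometry

variable {ι E F : Type*} [NormedAddCommGroup E] [InnerProductSpace ℝ E]
  [NormedAddCommGroup F] [InnerProductSpace ℝ F]

/-- Families with the same Gram matrix have linear combinations of the same norm. -/
theorem norm_linearCombination_eq_of_inner_eq {u : ι → E} {w : ι → F}
    (h : ∀ i j, inner ℝ (u i) (u j) = inner ℝ (w i) (w j)) (c : ι →₀ ℝ) :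
    ‖Finsupp.linearCombination ℝ u c‖ = ‖Finsupp.linearCombination ℝ w c‖ := by
  have key : inner ℝ (Finsupp.linearCombination ℝ u c) (Finsupp.linearCombination ℝ u c)
      = inner ℝ (Finsupp.linearCombination ℝ w c) (Finsupp.linearCombination ℝ w c) := by
    simp only [Finsupp.linearCombination_apply, Finsupp.sum, sum_inner, inner_sum,
      real_inner_smul_left, real_inner_smul_right, h]
  rw [real_inner_self_eq_norm_sq, real_inner_self_eq_norm_sq] at key
  exact (sq_eq_sq₀ (norm_nonneg _) (norm_nonneg _)).1 key

end GramIsometry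

/-! ### Deterministic integrands and step functions in L²(0, ∞) -/

/-- Lebesgue measure on `(0, ∞)`. -/
noncomputable abbrev halfLine : Measure ℝ := volume.restrict (Ioi 0)

/-- The `L²` space of `m`-dimensional deterministic integrands. -/
abbrev Integrands (m : ℕ) : Type := PiLp 2 (fun _ : Fin m => Lp ℝ 2 halfLine)

theorem halfLine_Ioc (a b : ℝ) (ha : 0 ≤ a) : halfLine (Ioc a b) = ENNReal.ofReal (b - a) := by
  rw [Measure.restrict_apply measurableSet_Ioc, inter_eq_left.2, Real.volume_Ioc]
  intro x hx
  exact lt_of_le_of_lt ha hx.1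

theorem halfLine_Ioc_ne_top (b : ℝ) : halfLine (Ioc 0 b) ≠ ∞ := by
  rw [halfLine_Ioc 0 b le_rfl]; exact ENNReal.ofReal_ne_top

/-- The indicator of `(0, s]` in `L²(0, ∞)`. -/
noncomputable def timeIndicator (s : ℝ≥0) : Lp ℝ 2 halfLine :=
  indicatorConstLp 2 (measurableSet_Ioc : MeasurableSet (Ioc 0 (s : ℝ)))
    (halfLine_Ioc_ne_top s) 1

theorem coeFn_timeIndicator (s : ℝ≥0) :
    (timeIndicator s : ℝ → ℝ) =ᵐ[halfLine] (Ioc 0 (s : ℝ)).indicator fun _ => 1 :=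
  indicatorConstLp_coeFn

theorem inner_timeIndicator (s t : ℝ≥0) :
    inner ℝ (timeIndicator s) (timeIndicator t) = ((min s t : ℝ≥0) : ℝ) := by
  rw [timeIndicator, timeIndicator, L2.real_inner_indicatorConstLp_one_indicatorConstLp_one
    (measurableSet_Ioc) (measurableSet_Ioc) (halfLine_Ioc_ne_top s) (halfLine_Ioc_ne_top t)]
  rw [Ioc_inter_Ioc, Measure.real, halfLine_Ioc _ _ (by simp)]
  rw [ENNReal.toReal_ofReal] <;> simp

/-- The integrand `1_{(0, s]}` in direction `k`. -/
noncomputable def unitIntegrand {m : ℕ} (p : Fin m × ℝ≥0) : Integrands m :=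
  PiLp.single 2 p.1 (timeIndicator p.2)

/-- This is the covariance of the Brownian values, computed in `inner_noise`; the coincidence of the
two Gram matrices is the Itô isometry on generators. -/
theorem inner_unitIntegrand {m : ℕ} (p q : Fin m × ℝ≥0) :
    inner ℝ (unitIntegrand p) (unitIntegrand q)
      = if p.1 = q.1 then ((min p.2 q.2 : ℝ≥0) : ℝ) else 0 := by
  rw [PiLp.inner_apply]
  rw [Finset.sum_eq_single p.1]
  · by_cases h : p.1 = q.1
    · simp [unitIntegrand, h, inner_timeIndicator]
    · simp [unitIntegrand, h]
  · intro k _ hk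
    simp [unitIntegrand, hk]
  · simp

section Step

theorem memLp_indicator_Ioc_const (a b : ℝ≥0) (c : ℝ) :
    MemLp ((Ioc (a : ℝ) b).indicator fun _ => c) 2 halfLine := by
  refine memLp_indicator_const 2 measurableSet_Ioc c (Or.inr ?_)
  rw [halfLine_Ioc _ _ a.coe_nonneg]; exact ENNReal.ofReal_ne_top

theorem TimeStep.memLp_toFun (e : TimeStep) : MemLp e.toFun 2 halfLine :=
  memLp_finsetSum _ fun _ _ => memLp_indicator_Ioc_const _ _ _

theorem timeIndicator_sub (a b : ℝ≥0) (hab : a ≤ b) (c : ℝ) :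
    c • (timeIndicator b - timeIndicator a) = (memLp_indicator_Ioc_const a b c).toLp _ := by
  refine Lp.ext ?_
  filter_upwards [Lp.coeFn_smul c (timeIndicator b - timeIndicator a),
    Lp.coeFn_sub (timeIndicator b) (timeIndicator a), coeFn_timeIndicator a,
    coeFn_timeIndicator b, (memLp_indicator_Ioc_const a b c).coeFn_toLp,
    ae_restrict_mem measurableSet_Ioi] with x h1 h2 h3 h4 h5 hx
  rw [h1, h5, Pi.smul_apply, h2, Pi.sub_apply, h3, h4]
  have hab' : (a : ℝ) ≤ b := hab
  have hx' : 0 < x := hx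
  simp only [indicator, mem_Ioc, smul_eq_mul, hx', true_and]
  grind

/-- Truncation at t caps both endpoints at t, which is exactly how `TimeStep.integral` stops the
Brownian increments. -/
theorem Ioc_indicator_indicator (a b t : ℝ≥0) (c x : ℝ) :
    (Ioc (0 : ℝ) t).indicator ((Ioc (a : ℝ) b).indicator fun _ => c) x
      = (Ioc ((min a t : ℝ≥0) : ℝ) ((min b t : ℝ≥0) : ℝ)).indicator (fun _ => c) x := by
  rw [indicator_indicator]
  have : Ioc (0 : ℝ) t ∩ Ioc (a : ℝ) b
      = Ioc ((min a t : ℝ≥0) : ℝ) ((min b t : ℝ≥0) : ℝ) := by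
    ext y
    simp only [mem_inter_iff, mem_Ioc, NNReal.coe_min, le_inf_iff, inf_lt_iff]
    have := a.2
    have ha : (0 : ℝ) ≤ a := a.2
    constructor
    · rintro ⟨⟨h1, h2⟩, h3, h4⟩; exact ⟨Or.inl h3, h4, h2⟩
    · rintro ⟨h1 | h1, h4, h2⟩
      · exact ⟨⟨by linarith, h2⟩, h1, h4⟩
      · exact absurd h1 (not_lt.2 h2)
  rw [this]

/-- A truncated step function as a combination of indicators. -/
theorem TimeStep.toLp_indicator (e : TimeStep) (t : ℝ≥0)
    (h : MemLp ((Ioc (0 : ℝ) t).indicator e.toFun) 2 halfLine) :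
    h.toLp _ = ∑ i : Fin e.len, e.val i •
      (timeIndicator (min (e.pts i.succ) t) - timeIndicator (min (e.pts i.castSucc) t)) := by
  have hmono : ∀ i : Fin e.len, min (e.pts i.castSucc) t ≤ min (e.pts i.succ) t := fun i =>
    min_le_min_right _ (e.mono (Fin.castSucc_lt_succ).le)
  simp_rw [fun i => timeIndicator_sub _ _ (hmono i) (e.val i)]
  refine Lp.ext ?_
  have h2 := Lp.coeFn_finsetSum (Finset.univ) (fun i : Fin e.len =>
    (memLp_indicator_Ioc_const (min (e.pts i.castSucc) t) (min (e.pts i.succ) t)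
      (e.val i)).toLp _)
  have h3 : ∀ᵐ x ∂halfLine, ∀ i : Fin e.len,
    (memLp_indicator_Ioc_const (min (e.pts i.castSucc) t) (min (e.pts i.succ) t)
      (e.val i)).toLp _ x = _ := ae_all_iff.2 fun i => MemLp.coeFn_toLp _
  filter_upwards [h.coeFn_toLp, h2, h3] with x h1 h2 h3
  rw [h1, h2, Finset.sum_apply]
  simp_rw [h3, ← Ioc_indicator_indicator]
  by_cases hx : x ∈ Ioc (0 : ℝ) t
  · simp [indicator_of_mem hx, TimeStep.toFun]
  · simp [indicator_of_notMem hx]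

end Step

/-! ### Brownian values as elements of L²(μ) -/

section Wiener

variable {Ω : Type*} [MeasurableSpace Ω] {μ : Measure Ω}
  {m : ℕ} {B : Fin m → ℝ≥0 → Ω → ℝ}

theorem IsStandardBrownian.memLp_two (hB : IsStandardBrownian B μ) (k : Fin m) (s : ℝ≥0) :
    MemLp (B k s) 2 μ :=
  ((hB.brownian k).hasLaw_eval s).hasGaussianLaw.memLp_two

/-- The value `B k s` of the Brownian motion in `L²(μ)`. -/
noncomputable def noise (hB : IsStandardBrownian B μ) (p : Fin m × ℝ≥0) : Lp ℝ 2 μ :=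
  (hB.memLp_two p.1 p.2).toLp _

theorem coeFn_noise (hB : IsStandardBrownian B μ) (p : Fin m × ℝ≥0) :
    noise hB p =ᵐ[μ] B p.1 p.2 := MemLp.coeFn_toLp _

/-- Finite linear combinations of the values of a standard Brownian motion are Gaussian. -/
theorem hasGaussianLaw_linearCombination_noise (hB : IsStandardBrownian B μ)
    (c : Fin m × ℝ≥0 →₀ ℝ) :
    HasGaussianLaw (Finsupp.linearCombination ℝ (noise hB) c : Lp ℝ 2 μ) μ := by
  classical
  -- One finite set of times serves all coordinates: each coordinate then contributes a linear image
  -- of a Gaussian vector, and these contributions are independent, so their sum is Gaussian.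
  set S : Finset ℝ≥0 := c.support.image Prod.snd with hS
  have h1 : ∀ k, HasGaussianLaw (fun ω => ∑ s ∈ S, c (k, s) • B k s ω) μ := fun k => by
    have := ((hB.brownian k).hasLaw S).hasGaussianLaw.map_fun
      (∑ s : S, c (k, s) • ContinuousLinearMap.proj (R := ℝ) (φ := fun _ : S => ℝ) s)
    refine this.congr (Eventually.of_forall fun ω => ?_)
    simp only [sum_apply, FunLike.coe_smul, Pi.smul_apply, ContinuousLinearMap.proj_apply,
      Finset.restrict]
    exact Finset.sum_coe_sort S fun s => c (k, s) • B k s ω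
  have h2 : iIndepFun (fun k ω => ∑ s ∈ S, c (k, s) • B k s ω) μ :=
    hB.indep.comp (fun k (f : ℝ≥0 → ℝ) => ∑ s ∈ S, c (k, s) • f s)
      (fun k => by fun_prop)
  have h3 := (h2.hasGaussianLaw h1).fun_sum
  refine h3.congr ?_
  have h4 : Finsupp.linearCombination ℝ (noise hB) c
      = ∑ k, ∑ s ∈ S, c (k, s) • noise hB (k, s) := by
    rw [Finsupp.linearCombination_apply, Finsupp.sum,
      ← Finset.sum_product' (f := fun k s => c (k, s) • noise hB (k, s))]
    refine Finset.sum_subset (fun p hp => ?_) (fun p _ hp => ?_)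
    · exact Finset.mem_product.2 ⟨Finset.mem_univ _, Finset.mem_image_of_mem _ hp⟩
    · simp [Finsupp.notMem_support_iff.1 hp]
  rw [h4]
  have h5 : ∀ᵐ ω ∂μ, ∀ k, ∀ s : S, (c (k, s) • noise hB (k, s) : Lp ℝ 2 μ) ω
      = c (k, (s : ℝ≥0)) • B k s ω := by
    refine ae_all_iff.2 fun k => ae_all_iff.2 fun s => ?_
    filter_upwards [Lp.coeFn_smul (c (k, s)) (noise hB (k, s)), coeFn_noise hB (k, s)]
      with ω h1 h2
    rw [h1, Pi.smul_apply, h2]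
  have h6 : ∀ᵐ ω ∂μ, ∀ k, (∑ s ∈ S, c (k, s) • noise hB (k, s) : Lp ℝ 2 μ) ω
      = ∑ s ∈ S, (c (k, s) • noise hB (k, s) : Lp ℝ 2 μ) ω := by
    refine ae_all_iff.2 fun k => ?_
    filter_upwards [Lp.coeFn_finsetSum S fun s => c (k, s) • noise hB (k, s)] with ω h
    rw [h, Finset.sum_apply]
  filter_upwards [h5, h6, Lp.coeFn_finsetSum Finset.univ
    fun k => ∑ s ∈ S, c (k, s) • noise hB (k, s)] with ω h5 h6 h7
  rw [h7, Finset.sum_apply]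
  refine Finset.sum_congr rfl fun k _ => ?_
  rw [h6]
  exact Finset.sum_congr rfl fun s hs => (h5 k ⟨s, hs⟩).symm

variable [IsProbabilityMeasure μ]

theorem inner_noise (hB : IsStandardBrownian B μ) (p q : Fin m × ℝ≥0) :
    inner ℝ (noise hB p) (noise hB q)
      = if p.1 = q.1 then ((min p.2 q.2 : ℝ≥0) : ℝ) else 0 := by
  have h : inner ℝ (noise hB p) (noise hB q) = cov[B p.1 p.2, B q.1 q.2; μ] := by
    rw [covariance_eq_sub (hB.memLp_two _ _) (hB.memLp_two _ _), (hB.brownian _).integral_eval,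
      zero_mul, sub_zero, L2.inner_def]
    refine integral_congr_ae ?_
    filter_upwards [coeFn_noise hB p, coeFn_noise hB q] with ω h1 h2
    simp [h1, h2, mul_comm]
  rw [h]
  split_ifs with hpq
  · rw [hpq, (hB.brownian _).covariance_eval]
  · have hi := (hB.indep.indepFun hpq).comp (φ := fun f : ℝ≥0 → ℝ => f p.2)
      (ψ := fun f : ℝ≥0 → ℝ => f q.2)
      (show Measurable fun f : ℝ≥0 → ℝ => f p.2 from measurable_pi_apply _)
      (show Measurable fun f : ℝ≥0 → ℝ => f q.2 from measurable_pi_apply _)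
    exact hi.covariance_eq_zero (hB.memLp_two _ _) (hB.memLp_two _ _)

theorem norm_linearCombination_noise (hB : IsStandardBrownian B μ) (c : Fin m × ℝ≥0 →₀ ℝ) :
    ‖Finsupp.linearCombination ℝ (noise hB) c‖
      = ‖Finsupp.linearCombination ℝ (unitIntegrand (m := m)) c‖ :=
  norm_linearCombination_eq_of_inner_eq
    (fun p q => by rw [inner_noise, inner_unitIntegrand]) c

theorem integral_linearCombination_noise (hB : IsStandardBrownian B μ)
    (c : Fin m × ℝ≥0 →₀ ℝ) : ∫ ω, Finsupp.linearCombination ℝ (noise hB) c ω ∂μ = 0 := by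
  have hL : ∀ f : Lp ℝ 2 μ, Integrable f μ := fun f => (Lp.memLp f).integrable (by norm_num)
  induction c using Finsupp.induction_linear with
  | zero =>
    rw [map_zero, integral_congr_ae (Lp.coeFn_zero ℝ 2 μ)]; simp
  | add c d hc hd =>
    rw [map_add, integral_congr_ae (Lp.coeFn_add _ _)]
    simp only [Pi.add_apply]
    rw [integral_add (hL _) (hL _), hc, hd, add_zero]
  | single p a =>
    rw [Finsupp.linearCombination_single, integral_congr_ae (Lp.coeFn_smul _ _)]
    simp only [Pi.smul_apply]
    rw [integral_smul, integral_congr_ae (coeFn_noise hB p), (hB.brownian _).integral_eval,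
      smul_zero]

/-- `L²` random variables with the characteristic function of a centred Gaussian form a closed
set. -/
theorem isClosed_setOf_charFun_gaussian (ξ : ℝ) :
    IsClosed {Y : Lp ℝ 2 μ | ∫ ω, Complex.exp (ξ * Y ω * Complex.I) ∂μ
      = Complex.exp (-(‖Y‖ ^ 2 : ℝ) * ξ ^ 2 / 2)} := by
  refine isClosed_eq ?_ (by fun_prop)
  have hint : ∀ Y : Lp ℝ 2 μ, Integrable (fun ω => Complex.exp (ξ * Y ω * Complex.I)) μ := by
    intro Y
    refine Integrable.of_bound (C := 1) ?_ (ae_of_all _ fun ω => ?_)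
    · have := (Lp.aestronglyMeasurable Y).aemeasurable
      exact AEMeasurable.aestronglyMeasurable (by fun_prop)
    · rw [← Complex.ofReal_mul, Complex.norm_exp_ofReal_mul_I]
  -- Since |e^{ia} - 1| ≤ |a|, the map Y ↦ E e^{iξY} is |ξ|-Lipschitz for the L¹ norm, hence for the
  -- L² norm because μ is a probability measure.
  refine (LipschitzWith.of_dist_le_mul (K := ‖ξ‖₊) fun Y Z => ?_).continuous
  rw [dist_eq_norm, dist_eq_norm, ← integral_sub (hint Y) (hint Z)]
  have hYZ : Integrable (Y - Z : Lp ℝ 2 μ) μ := (Lp.memLp _).integrable (by norm_num)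
  calc ‖∫ ω, (Complex.exp (ξ * Y ω * Complex.I) - Complex.exp (ξ * Z ω * Complex.I)) ∂μ‖
      ≤ ∫ ω, ‖ξ‖ * ‖(Y - Z : Lp ℝ 2 μ) ω‖ ∂μ := by
        refine norm_integral_le_of_norm_le (hYZ.norm.const_mul _) ?_
        filter_upwards [Lp.coeFn_sub Y Z] with ω hω
        rw [hω, Pi.sub_apply, ← norm_mul, mul_sub]
        have := Real.norm_exp_I_mul_ofReal_sub_one_le (x := ξ * Y ω - ξ * Z ω)
        have h2 : Complex.exp (ξ * Y ω * Complex.I) - Complex.exp (ξ * Z ω * Complex.I)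
            = Complex.exp ((ξ * Z ω : ℝ) * Complex.I)
              * (Complex.exp (Complex.I * (ξ * Y ω - ξ * Z ω : ℝ)) - 1) := by
          rw [mul_sub, ← Complex.exp_add, mul_one]
          push_cast
          ring_nf
        rw [h2, norm_mul, Complex.norm_exp_ofReal_mul_I, one_mul]
        exact this
    _ = ‖ξ‖ * ∫ ω, ‖(Y - Z : Lp ℝ 2 μ) ω‖ ∂μ := integral_const_mul _ _
    _ ≤ ‖ξ‖₊ * ‖Y - Z‖ := by
        refine mul_le_mul_of_nonneg_left ?_ (norm_nonneg _)
        rw [Lp.norm_def, integral_norm_eq_lintegral_enorm (Lp.aestronglyMeasurable _),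
          ← eLpNorm_one_eq_lintegral_enorm]
        exact ENNReal.toReal_mono (Lp.eLpNorm_ne_top _)
          (eLpNorm_le_eLpNorm_of_exponent_le (by norm_num) (Lp.aestronglyMeasurable _))

end Wiener

/-! ### Density of step functions -/

section Density

/-- The step function interpolating `g` from the right endpoints of the uniform partition of
`(0, N δ]` into `N` intervals of length `δ`. -/
noncomputable def TimeStep.sample (g : ℝ → ℝ) (δ : ℝ≥0) (N : ℕ) : TimeStep where
  len := N
  pts i := (i : ℕ) * δ
  mono i j hij := by
    have : ((i : ℕ) : ℝ≥0) ≤ (j : ℕ) := by exact_mod_cast hij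
    exact mul_le_mul_left this δ
  val i := g ((i + 1 : ℕ) * δ)

theorem TimeStep.toFun_sample (g : ℝ → ℝ) (δ : ℝ≥0) (N : ℕ) (x : ℝ) :
    (TimeStep.sample g δ N).toFun x = ∑ i : Fin N,
      (Ioc ((i : ℕ) * δ : ℝ) (((i : ℕ) + 1 : ℕ) * δ)).indicator
        (fun _ => g (((i : ℕ) + 1 : ℕ) * δ)) x := by
  unfold TimeStep.toFun
  refine Fintype.sum_congr (α := Fin N) _ _ fun i => ?_
  simp [TimeStep.sample]

theorem TimeStep.sample_apply_of_mem (g : ℝ → ℝ) {δ : ℝ≥0} {N i : ℕ} (hi : i < N) {x : ℝ}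
    (hx : x ∈ Ioc (i * δ : ℝ) ((i + 1 : ℕ) * δ)) :
    (TimeStep.sample g δ N).toFun x = g ((i + 1 : ℕ) * δ) := by
  rw [TimeStep.toFun_sample, Finset.sum_eq_single (⟨i, hi⟩ : Fin N)]
  · rw [indicator_of_mem hx]
  · intro j _ hj
    refine indicator_of_notMem (fun hx' => ?_) _
    have h1' := lt_of_mul_lt_mul_right (hx.1.trans_le hx'.2) δ.coe_nonneg
    have h2' := lt_of_mul_lt_mul_right (hx'.1.trans_le hx.2) δ.coe_nonneg
    norm_cast at h1' h2'
    exact hj (Fin.ext (by change (j : ℕ) = i; omega))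
  · simp

theorem TimeStep.sample_apply_of_lt (g : ℝ → ℝ) {δ : ℝ≥0} {N : ℕ} {x : ℝ}
    (hx : (N * δ : ℝ) < x) : (TimeStep.sample g δ N).toFun x = 0 := by
  rw [TimeStep.toFun_sample]
  refine Finset.sum_eq_zero fun j _ => indicator_of_notMem (fun hx' => ?_) _
  have h1 := lt_of_mul_lt_mul_right (hx.trans_le hx'.2) δ.coe_nonneg
  have h2 : N < (j : ℕ) + 1 := by exact_mod_cast h1
  omega

/-- Uniform continuity on a fine enough grid. The bound R is chosen before ε, so the error lives on
a set of fixed finite measure and uniform smallness yields L² smallness. -/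
theorem exists_timeStep_uniform {g : ℝ → ℝ} (hg : Continuous g) (hc : HasCompactSupport g) :
    ∃ R : ℝ, 0 < R ∧ ∀ ε : ℝ, 0 < ε → ∃ e : TimeStep,
      (∀ x, 0 < x → ‖e.toFun x - g x‖ ≤ ε) ∧ ∀ x, R < x → e.toFun x - g x = 0 := by
  obtain ⟨R, hR⟩ := hc.isCompact.isBounded.subset_closedBall (0 : ℝ)
  have hR' : ∀ x, max R 1 < x → g x = 0 := fun x hx => by
    by_contra hne
    have := hR (subset_tsupport g hne)
    rw [Metric.mem_closedBall, dist_zero_right] at this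
    exact absurd (((le_max_left R 1).trans_lt hx).trans_le (le_abs_self x)) (not_lt.2 this)
  have hpos : 0 < max R 1 := lt_max_of_lt_right one_pos
  generalize max R 1 = R at hR' hpos
  refine ⟨R, hpos, fun ε hε => ?_⟩
  obtain ⟨η, hη, hunif⟩ := Metric.uniformContinuous_iff.1
    (hc.uniformContinuous_of_continuous hg) ε hε
  obtain ⟨N, hN⟩ := exists_nat_gt (R / η)
  have hN0 : (0 : ℝ) < N := (div_pos hpos hη).trans hN
  set δ : ℝ≥0 := ⟨R / N, (div_pos hpos hN0).le⟩ with hδ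
  have hδR : (δ : ℝ) = R / N := rfl
  have hδ0 : (0 : ℝ) < δ := div_pos hpos hN0
  have hδη : (δ : ℝ) < η := by
    rw [hδR, div_lt_iff₀ hN0]; rwa [div_lt_iff₀ hη, mul_comm] at hN
  have hNδ : (N : ℝ) * δ = R := by rw [hδR]; field_simp
  have hout : ∀ x, R < x → (TimeStep.sample g δ N).toFun x - g x = 0 := fun x hx => by
    rw [TimeStep.sample_apply_of_lt g (hNδ ▸ hx), hR' x hx, sub_zero]
  refine ⟨TimeStep.sample g δ N, fun x hx => ?_, hout⟩
  rcases lt_or_ge R x with hRx | hRx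
  · rw [hout x hRx, norm_zero]; exact hε.le
  -- The cells are open on the left and closed on the right, so the cell of x is found with the
  -- ceiling: its right endpoint is ⌈x/δ⌉ δ.
  · have hc0 : 0 < ⌈x / δ⌉₊ := Nat.ceil_pos.2 (div_pos hx hδ0)
    obtain ⟨i, hi⟩ : ∃ i, ⌈x / δ⌉₊ = i + 1 := ⟨_, (Nat.succ_pred_eq_of_pos hc0).symm⟩
    have h1 : x ≤ ((i + 1 : ℕ) : ℝ) * δ := by
      rw [← div_le_iff₀ hδ0, ← hi]; exact Nat.le_ceil _
    have h2 : (i : ℝ) * δ < x := by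
      rw [← lt_div_iff₀ hδ0]
      exact Nat.lt_ceil.1 (by omega)
    have h3 : i < N := by
      have : (i : ℝ) * δ < N * δ := h2.trans_le (hRx.trans hNδ.ge)
      exact_mod_cast lt_of_mul_lt_mul_right this δ.coe_nonneg
    rw [TimeStep.sample_apply_of_mem g h3 ⟨h2, h1⟩, ← dist_eq_norm]
    refine (hunif ?_).le
    rw [Real.dist_eq, abs_of_nonneg (by linarith)]
    push_cast at h1 ⊢
    linarith

/-- Step functions are dense in `L²(0, ∞)`. -/
theorem exists_timeStep_eLpNorm_sub_le {f : ℝ → ℝ} (hf : MemLp f 2 halfLine) {ε : ℝ≥0∞}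
    (hε : ε ≠ 0) : ∃ e : TimeStep, eLpNorm (fun x => e.toFun x - f x) 2 halfLine ≤ ε := by
  have hε2 : ε / 2 ≠ 0 := by simpa using hε
  have hf' : MemLp ((Ioi 0).indicator f) 2 volume :=
    (memLp_indicator_iff_restrict measurableSet_Ioi).2 hf
  obtain ⟨g, hgc, hg, hgcont, hgm⟩ :=
    hf'.exists_hasCompactSupport_eLpNorm_sub_le (by norm_num) hε2
  obtain ⟨R, hR, happ⟩ := exists_timeStep_uniform hgcont hgc
  have hK : halfLine (Ioc 0 R) ^ (1 / (2 : ℝ≥0∞).toReal) ≠ ∞ :=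
    ENNReal.rpow_ne_top_of_nonneg (by positivity) (halfLine_Ioc_ne_top R)
  obtain ⟨η, hη, hηK⟩ := ENNReal.exists_nnreal_pos_mul_lt hK hε2
  obtain ⟨e, he1, he2⟩ := happ η (by exact_mod_cast hη)
  refine ⟨e, ?_⟩
  have h1 : eLpNorm (fun x => e.toFun x - g x) 2 halfLine ≤ ε / 2 := by
    refine le_trans ?_ hηK.le
    refine (eLpNorm_mono_ae (g := (Ioc 0 R).indicator fun _ => (η : ℝ)) ?_).trans ?_
    · filter_upwards [ae_restrict_mem measurableSet_Ioi] with x hx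
      rcases le_or_gt x R with hxR | hxR
      · rw [indicator_of_mem (show x ∈ Ioc 0 R from ⟨hx, hxR⟩)]
        simpa using he1 x hx
      · rw [he2 x hxR, norm_zero]; exact norm_nonneg _
    · refine (eLpNorm_indicator_const_le _ _).trans ?_
      simp
  have h2 : eLpNorm (fun x => g x - f x) 2 halfLine ≤ ε / 2 := by
    refine le_trans (le_of_eq_of_le (b := eLpNorm ((Ioi 0).indicator f - g) 2 halfLine) ?_
      (eLpNorm_mono_measure _ (Measure.restrict_le_self (s := Ioi 0)))) hg
    rw [← eLpNorm_neg]
    refine eLpNorm_congr_ae ?_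
    filter_upwards [ae_restrict_mem measurableSet_Ioi] with x hx
    simp [indicator_of_mem hx]
  calc eLpNorm (fun x => e.toFun x - f x) 2 halfLine
      = eLpNorm ((fun x => e.toFun x - g x) + fun x => g x - f x) 2 halfLine := by
        congr 1; ext x; simp
    _ ≤ _ := eLpNorm_add_le (e.memLp_toFun.1.sub hgcont.aestronglyMeasurable)
        (hgcont.aestronglyMeasurable.sub hf.1) (by norm_num)
    _ ≤ ε / 2 + ε / 2 := add_le_add h1 h2
    _ = ε := ENNReal.add_halves ε

theorem exists_timeStep_seq {f : ℝ → ℝ} (hf : MemLp f 2 halfLine) :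
    ∃ e : ℕ → TimeStep,
      Tendsto (fun N => eLpNorm (fun x => (e N).toFun x - f x) 2 halfLine) atTop (𝓝 0) := by
  have h : ∀ N : ℕ, ∃ e : TimeStep,
      eLpNorm (fun x => e.toFun x - f x) 2 halfLine ≤ ((N : ℝ≥0∞) + 1)⁻¹ := fun N =>
    exists_timeStep_eLpNorm_sub_le hf (by simp)
  choose e he using h
  refine ⟨e, tendsto_of_tendsto_of_tendsto_of_le_of_le tendsto_const_nhds ?_
    (fun _ => zero_le) he⟩
  have := (tendsto_add_atTop_iff_nat 1).2 ENNReal.tendsto_inv_nat_nhds_zero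
  simpa using this

theorem TimeStep.toFun_toLp_mem_span (e : TimeStep) :
    e.memLp_toFun.toLp _ ∈ Submodule.span ℝ (range timeIndicator) := by
  -- Truncating at the last grid point changes nothing, so the formula for truncated step functions
  -- applies.
  set t := e.pts (Fin.last _)
  have ht : (Ioc (0 : ℝ) t).indicator e.toFun = e.toFun := by
    refine indicator_eq_self.2 fun x hx => ?_
    obtain ⟨i, -, hi⟩ := Finset.exists_ne_zero_of_sum_ne_zero hx
    have hi' := mem_of_indicator_ne_zero hi
    exact ⟨(e.pts i.castSucc).coe_nonneg.trans_lt hi'.1,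
      hi'.2.trans (NNReal.coe_le_coe.2 (e.mono (Fin.le_last _)))⟩
  have hm : MemLp ((Ioc (0 : ℝ) t).indicator e.toFun) 2 halfLine := ht.symm ▸ e.memLp_toFun
  rw [← MemLp.toLp_congr hm e.memLp_toFun (by rw [ht]), e.toLp_indicator t hm]
  exact Submodule.sum_mem _ fun i _ => Submodule.smul_mem _ _
    (Submodule.sub_mem _ (Submodule.subset_span (mem_range_self _))
      (Submodule.subset_span (mem_range_self _)))

theorem dense_span_timeIndicator :
    (Submodule.span ℝ (range timeIndicator)).topologicalClosure = ⊤ := by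
  refine Submodule.eq_top_iff'.2 fun f => ?_
  obtain ⟨e, he⟩ := exists_timeStep_seq (Lp.memLp f)
  refine mem_closure_of_tendsto (f := fun N => (e N).memLp_toFun.toLp _) (b := atTop) ?_
    (Eventually.of_forall fun N => (e N).toFun_toLp_mem_span)
  rw [Lp.tendsto_Lp_iff_tendsto_eLpNorm']
  refine he.congr fun N => eLpNorm_congr_ae ?_
  filter_upwards [(e N).memLp_toFun.coeFn_toLp] with x hx
  simp [hx]

/-- An integrand in direction `k`. -/
noncomputable def integrandSingle {m : ℕ} (k : Fin m) : Lp ℝ 2 halfLine →L[ℝ] Integrands m :=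
  ((PiLp.continuousLinearEquiv 2 ℝ fun _ : Fin m => Lp ℝ 2 halfLine).symm :
    (Fin m → Lp ℝ 2 halfLine) →L[ℝ] Integrands m) ∘L ContinuousLinearMap.single ℝ (fun _ => Lp ℝ 2 halfLine) k

theorem integrandSingle_timeIndicator {m : ℕ} (k : Fin m) (s : ℝ≥0) :
    integrandSingle k (timeIndicator s) = unitIntegrand (k, s) := rfl

theorem sum_integrandSingle {m : ℕ} (h : Integrands m) : ∑ k, integrandSingle k (h k) = h := by
  refine PiLp.ext fun l => ?_
  simp [integrandSingle, Finset.sum_apply, Pi.single_apply]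

/-- Every integrand is the sum of its coordinates, and each coordinate embedding, being continuous,
maps the closed span of the time indicators into the closed span of the unit integrands. -/
theorem denseRange_linearCombination_unitIntegrand (m : ℕ) :
    DenseRange (Finsupp.linearCombination ℝ (unitIntegrand (m := m))) := by
  set S := Submodule.span ℝ (range (unitIntegrand (m := m))) with hS
  suffices h : S.topologicalClosure = ⊤ by
    have h2 := congrArg (fun p : Submodule ℝ (Integrands m) => (p : Set (Integrands m))) h
    simp only [Submodule.topologicalClosure_coe, Submodule.top_coe] at h2
    rw [DenseRange, ← LinearMap.coe_range, Finsupp.range_linearCombination, ← hS]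
    exact dense_iff_closure_eq.2 h2
  refine Submodule.eq_top_iff'.2 fun h => ?_
  rw [← sum_integrandSingle h]
  refine Submodule.sum_mem _ fun k _ => ?_
  have hle : (Submodule.span ℝ (range timeIndicator)).topologicalClosure
      ≤ S.topologicalClosure.comap (integrandSingle k : Lp ℝ 2 halfLine →ₗ[ℝ] Integrands m) := by
    refine Submodule.topologicalClosure_minimal _ (Submodule.span_le.2 ?_)
      (S.isClosed_topologicalClosure.preimage (integrandSingle k).continuous)
    rintro _ ⟨s, rfl⟩
    exact S.le_topologicalClosure (Submodule.subset_span ⟨(k, s), rfl⟩)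
  rw [dense_span_timeIndicator] at hle
  exact hle (Submodule.mem_top (x := h k))

end Density

/-! ### The Wiener integral as a Gaussian isometry -/

section WienerMap

variable {Ω : Type*} [MeasurableSpace Ω] {μ : Measure Ω}
  {m : ℕ} {B : Fin m → ℝ≥0 → Ω → ℝ}

theorem integral_sq_Lp (Y : Lp ℝ 2 μ) : ∫ ω, Y ω ^ 2 ∂μ = ‖Y‖ ^ 2 := by
  rw [← real_inner_self_eq_norm_sq, L2.inner_def]
  simp [sq]

variable [IsProbabilityMeasure μ]

/-- The Wiener integral over `(0, ∞)` as an operator into `L²(μ)`. -/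
noncomputable def wienerMap (hB : IsStandardBrownian B μ) : Integrands m →L[ℝ] Lp ℝ 2 μ :=
  (Finsupp.linearCombination ℝ (noise hB)).extendOfNorm
    (Finsupp.linearCombination ℝ unitIntegrand)

/-- The conditions under which `extendOfNorm` really extends are verified here: dense range, and a
norm bound with constant 1 from the equality of Gram matrices. -/
theorem wienerMap_linearCombination (hB : IsStandardBrownian B μ) (c : Fin m × ℝ≥0 →₀ ℝ) :
    wienerMap hB (Finsupp.linearCombination ℝ unitIntegrand c)
      = Finsupp.linearCombination ℝ (noise hB) c :=
  LinearMap.extendOfNorm_eq (denseRange_linearCombination_unitIntegrand m)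
    ⟨1, fun c => by rw [norm_linearCombination_noise, one_mul]⟩ c

theorem wienerMap_unitIntegrand (hB : IsStandardBrownian B μ) (p : Fin m × ℝ≥0) :
    wienerMap hB (unitIntegrand p) = noise hB p := by
  have := wienerMap_linearCombination hB (Finsupp.single p 1)
  simpa using this

theorem norm_wienerMap (hB : IsStandardBrownian B μ) (h : Integrands m) :
    ‖wienerMap hB h‖ = ‖h‖ := by
  refine (denseRange_linearCombination_unitIntegrand m).induction_on
    (p := fun h => ‖wienerMap hB h‖ = ‖h‖) h (isClosed_eq (by fun_prop) (by fun_prop)) fun c => ?_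
  rw [wienerMap_linearCombination, norm_linearCombination_noise]

/-- On finite combinations the law is Gaussian with variance equal to the squared L² norm;
closedness of the condition carries it to all integrands. -/
theorem charFun_wienerMap (hB : IsStandardBrownian B μ) (h : Integrands m) (ξ : ℝ) :
    ∫ ω, Complex.exp (ξ * wienerMap hB h ω * Complex.I) ∂μ
      = Complex.exp (-(‖wienerMap hB h‖ ^ 2 : ℝ) * ξ ^ 2 / 2) := by
  refine (denseRange_linearCombination_unitIntegrand m).induction_on
    (p := fun h => ∫ ω, Complex.exp (ξ * wienerMap hB h ω * Complex.I) ∂μ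
      = Complex.exp (-(‖wienerMap hB h‖ ^ 2 : ℝ) * ξ ^ 2 / 2)) h
    ((isClosed_setOf_charFun_gaussian (μ := μ) ξ).preimage (wienerMap hB).continuous) fun c => ?_
  rw [wienerMap_linearCombination]
  set Y := Finsupp.linearCombination ℝ (noise hB) c
  have hG : HasGaussianLaw Y μ := hasGaussianLaw_linearCombination_noise hB c
  have hmap := hG.map_eq_gaussianReal
  have hvar : Var[Y; μ] = ‖Y‖ ^ 2 := by
    rw [variance_of_integral_eq_zero hG.aemeasurable (integral_linearCombination_noise hB c),
      integral_sq_Lp]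
  rw [integral_linearCombination_noise, hvar] at hmap
  have h1 := charFun_gaussianReal (μ := 0) (v := (‖Y‖ ^ 2).toNNReal) ξ
  rw [← hmap, charFun_apply_real, integral_map hG.aemeasurable
    (Continuous.aestronglyMeasurable (by fun_prop)), Real.coe_toNNReal _ (sq_nonneg _)] at h1
  rw [h1]
  congr 1
  push_cast
  ring

/-- Wiener integrals are centred Gaussian with the Itô isometry variance. -/
theorem map_wienerMap (hB : IsStandardBrownian B μ) (h : Integrands m) :
    μ.map (wienerMap hB h) = gaussianReal 0 (‖h‖ ^ 2).toNNReal := by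
  have hm : AEMeasurable (wienerMap hB h) μ := (Lp.aestronglyMeasurable _).aemeasurable
  have := Measure.isProbabilityMeasure_map hm
  refine Measure.ext_of_charFun (funext fun ξ => ?_)
  rw [charFun_gaussianReal, charFun_apply_real, integral_map hm
    (Continuous.aestronglyMeasurable (by fun_prop)), charFun_wienerMap, norm_wienerMap,
    Real.coe_toNNReal _ (sq_nonneg _)]
  congr 1
  push_cast
  ring

/-- Exponential moments of Wiener integrals. -/
theorem integral_exp_wienerMap (hB : IsStandardBrownian B μ) (h : Integrands m) (a : ℝ) :
    ∫ ω, Real.exp (a * wienerMap hB h ω) ∂μ = Real.exp (a ^ 2 / 2 * ‖h‖ ^ 2) := by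
  have := mgf_gaussianReal (map_wienerMap hB h) a
  rw [mgf, Real.coe_toNNReal _ (sq_nonneg _)] at this
  rw [this]
  ring_nf

theorem integrable_exp_wienerMap (hB : IsStandardBrownian B μ) (h : Integrands m) (a : ℝ) :
    Integrable (fun ω => Real.exp (a * wienerMap hB h ω)) μ := by
  -- The integral of a non-integrable function is 0 by convention, so a nonzero value already proves
  -- integrability.
  refine Integrable.of_integral_ne_zero ?_
  rw [integral_exp_wienerMap]
  exact (Real.exp_pos _).ne'

/-- The truncation `1_{(0, t]} f` in `L²(0, ∞)`. -/
noncomputable def truncate (f : Lp ℝ 2 halfLine) (t : ℝ) : Lp ℝ 2 halfLine :=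
  ((Lp.memLp f).indicator (measurableSet_Ioc : MeasurableSet (Ioc 0 t))).toLp _

theorem coeFn_truncate (f : Lp ℝ 2 halfLine) (t : ℝ) :
    truncate f t =ᵐ[halfLine] (Ioc 0 t).indicator f := MemLp.coeFn_toLp _

theorem halfLine_restrict_Ioc (t : ℝ) :
    halfLine.restrict (Ioc 0 t) = volume.restrict (Ioc 0 t) := by
  rw [Measure.restrict_restrict measurableSet_Ioc, inter_eq_left.2 Ioc_subset_Ioi_self]

theorem eLpNorm_indicator_Ioc (f : ℝ → ℝ) (t : ℝ) :
    eLpNorm ((Ioc 0 t).indicator f) 2 halfLine = eLpNorm f 2 (volume.restrict (Ioc 0 t)) := by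
  rw [eLpNorm_indicator_eq_eLpNorm_restrict measurableSet_Ioc, halfLine_restrict_Ioc]

theorem memLp_indicator_Ioc_iff (f : ℝ → ℝ) (t : ℝ) :
    MemLp ((Ioc 0 t).indicator f) 2 halfLine ↔ MemLp f 2 (volume.restrict (Ioc 0 t)) := by
  rw [memLp_indicator_iff_restrict measurableSet_Ioc, halfLine_restrict_Ioc]

theorem TimeStep.integral_ae_eq (hB : IsStandardBrownian B μ) (e : TimeStep) (k : Fin m)
    (t : ℝ≥0) (h : MemLp ((Ioc (0 : ℝ) t).indicator e.toFun) 2 halfLine) :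
    wienerMap hB (integrandSingle k (h.toLp _)) =ᵐ[μ] e.integral (B k) t := by
  rw [e.toLp_indicator t h]
  simp only [map_sum, map_smul, map_sub, integrandSingle_timeIndicator, wienerMap_unitIntegrand]
  have h2 : ∀ᵐ ω ∂μ, ∀ i : Fin e.len, (e.val i •
      (noise hB (k, min (e.pts i.succ) t) - noise hB (k, min (e.pts i.castSucc) t)) : Lp ℝ 2 μ) ω
      = e.val i * (B k (min (e.pts i.succ) t) ω - B k (min (e.pts i.castSucc) t) ω) := by
    refine ae_all_iff.2 fun i => ?_
    filter_upwards [Lp.coeFn_smul (e.val i)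
      (noise hB (k, min (e.pts i.succ) t) - noise hB (k, min (e.pts i.castSucc) t)),
      Lp.coeFn_sub (noise hB (k, min (e.pts i.succ) t)) (noise hB (k, min (e.pts i.castSucc) t)),
      coeFn_noise hB (k, min (e.pts i.succ) t), coeFn_noise hB (k, min (e.pts i.castSucc) t)]
      with ω h1 h2 h3 h4
    rw [h1, Pi.smul_apply, h2, Pi.sub_apply, h3, h4, smul_eq_mul]
  filter_upwards [h2, Lp.coeFn_finsetSum Finset.univ fun i : Fin e.len => e.val i •
      (noise hB (k, min (e.pts i.succ) t) - noise hB (k, min (e.pts i.castSucc) t))] with ω h2 h3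
  rw [h3, Finset.sum_apply]
  exact Finset.sum_congr rfl fun i _ => h2 i

theorem TimeStep.memLp_indicator (e : TimeStep) (t : ℝ) :
    MemLp ((Ioc 0 t).indicator e.toFun) 2 halfLine := e.memLp_toFun.indicator measurableSet_Ioc

theorem tendsto_truncate_timeStep {f : ℝ → ℝ} {F : Lp ℝ 2 halfLine} {t : ℝ≥0}
    (hF : F =ᵐ[volume.restrict (Ioc 0 (t : ℝ))] f) {e : ℕ → TimeStep}
    (he : Tendsto (fun N => eLpNorm (fun s => (e N).toFun s - f s) 2
        (volume.restrict (Ioc 0 (t : ℝ)))) atTop (𝓝 0)) :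
    Tendsto (fun N => ((e N).memLp_indicator t).toLp _) atTop (𝓝 (truncate F t)) := by
  rw [truncate, Lp.tendsto_Lp_iff_tendsto_eLpNorm'']
  refine he.congr fun N => ?_
  rw [← Set.indicator_sub', eLpNorm_indicator_Ioc]
  refine eLpNorm_congr_ae ?_
  filter_upwards [hF] with x hx
  simp [hx]

/-- Wiener integrals of deterministic functions are the values of the Wiener operator. -/
theorem IsWienerIntegral.ae_eq (hB : IsStandardBrownian B μ) {k : Fin m} {f : ℝ → ℝ} {t : ℝ≥0}
    {Y : Ω → ℝ} (hY : IsWienerIntegral (B k) μ f t Y) {F : Lp ℝ 2 halfLine}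
    (hF : F =ᵐ[volume.restrict (Ioc 0 (t : ℝ))] f) :
    Y =ᵐ[μ] wienerMap hB (integrandSingle k (truncate F t)) := by
  obtain ⟨-, hY2, e, he1, he2⟩ := hY
  -- The elementary integrals are the images of the truncated step functions. They converge both to
  -- `Y` and to the operator value, so the choice of approximating steps does not matter.
  have h1 := ((wienerMap hB).continuous.comp (integrandSingle k).continuous).tendsto _ |>.comp
    (tendsto_truncate_timeStep hF he1)
  have h2 : Tendsto (fun N => wienerMap hB (integrandSingle k
      (((e N).memLp_indicator t).toLp _))) atTop (𝓝 (hY2.toLp Y)) := by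
    rw [Lp.tendsto_Lp_iff_tendsto_eLpNorm']
    refine he2.congr fun N => eLpNorm_congr_ae ?_
    filter_upwards [(e N).integral_ae_eq hB k t ((e N).memLp_indicator t), hY2.coeFn_toLp]
      with ω h3 h4
    simp [h3, h4]
  have h3 := tendsto_nhds_unique h2 h1
  have h4 := hY2.coeFn_toLp
  rw [h3] at h4
  exact h4.symm

theorem isWienerIntegral_of_ae_eq (hB : IsStandardBrownian B μ) {k : Fin m} {f : ℝ → ℝ} {t : ℝ≥0}
    {Y : Ω → ℝ} {F : Lp ℝ 2 halfLine} (hF : F =ᵐ[volume.restrict (Ioc 0 (t : ℝ))] f)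
    (hY : Y =ᵐ[μ] wienerMap hB (integrandSingle k (truncate F t))) :
    IsWienerIntegral (B k) μ f t Y := by
  obtain ⟨e, he⟩ := exists_timeStep_seq (Lp.memLp F)
  have hFm : MemLp F 2 (volume.restrict (Ioc 0 (t : ℝ))) :=
    (Lp.memLp F).mono_measure (Measure.restrict_mono_set _ Ioc_subset_Ioi_self)
  have he' : Tendsto (fun N => eLpNorm (fun s => (e N).toFun s - f s) 2
        (volume.restrict (Ioc 0 (t : ℝ)))) atTop (𝓝 0) := by
    refine tendsto_of_tendsto_of_tendsto_of_le_of_le tendsto_const_nhds he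
      (fun _ => zero_le) fun N => ?_
    refine le_of_eq_of_le (eLpNorm_congr_ae ?_)
      (eLpNorm_mono_measure _ (Measure.restrict_mono_set _ Ioc_subset_Ioi_self))
    filter_upwards [hF] with x hx
    rw [hx]
  refine ⟨hFm.ae_eq hF, (Lp.memLp _).ae_eq hY.symm, e, he', ?_⟩
  have h1 := ((wienerMap hB).continuous.comp (integrandSingle k).continuous).tendsto _ |>.comp
    (tendsto_truncate_timeStep hF he')
  rw [Lp.tendsto_Lp_iff_tendsto_eLpNorm'] at h1
  refine h1.congr fun N => eLpNorm_congr_ae ?_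
  filter_upwards [(e N).integral_ae_eq hB k t ((e N).memLp_indicator t), hY] with ω h3 h4
  simp [h3, h4]

end WienerMap

/-! ### Linear Volterra equations -/

section Deterministic

/-- Integration by parts against a primitive. -/
theorem integral_deriv_mul_primitive {a a' h : ℝ → ℝ} {t : ℝ}
    (ha : ∀ x, HasDerivAt a (a' x) x) (ha' : Continuous a')
    (hh : IntervalIntegrable h volume 0 t) :
    ∫ s in (0 : ℝ)..t, a' s * (∫ u in (0 : ℝ)..s, h u)
      = ∫ s in (0 : ℝ)..t, (a t - a s) * h s := by
  have hder : deriv a = a' := funext fun x => (ha x).deriv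
  have hca : Continuous a := continuous_iff_continuousAt.2 fun x => (ha x).continuousAt
  have hC1 : ContDiff ℝ 1 a := by
    rw [contDiff_one_iff_deriv, hder]
    exact ⟨fun x => (ha x).differentiableAt, ha'⟩
  -- The primitive of an integrable function is only absolutely continuous, with derivative `h`
  -- almost everywhere; integration by parts is used in that generality.
  have hg := hh.absolutelyContinuousOnInterval_intervalIntegral (c := 0) (by simp)
  have key := (hC1.contDiffOn.absolutelyContinuousOnInterval (a := 0)
    (b := t)).integral_mul_deriv_eq_deriv_mul hg
  have h1 : ∫ x in (0 : ℝ)..t, a x * deriv (fun x => ∫ u in (0 : ℝ)..x, h u) x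
      = ∫ x in (0 : ℝ)..t, a x * h x := by
    refine intervalIntegral.integral_congr_ae ?_
    filter_upwards [hh.ae_hasDerivAt_integral] with x hx hxt
    rw [(hx (uIoc_subset_uIcc hxt) 0 (by simp)).deriv]
  rw [h1, hder] at key
  simp only [sub_mul]
  rw [intervalIntegral.integral_sub (hh.const_mul _) (hh.continuousOn_mul hca.continuousOn),
    intervalIntegral.integral_const_mul]
  simp only [intervalIntegral.integral_same, mul_zero, sub_zero] at key
  linarith

theorem hasDerivAt_exp_mul (c d x : ℝ) :
    HasDerivAt (fun s => Real.exp (c * s + d)) (c * Real.exp (c * x + d)) x := by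
  have := (((hasDerivAt_id x).const_mul c).add_const d).exp
  simpa [mul_comm] using this

/-- The exponential kernel applied to a primitive. -/
theorem integral_exp_mul_primitive {h : ℝ → ℝ} {t : ℝ} (r : ℝ)
    (hh : IntervalIntegrable h volume 0 t) :
    ∫ s in (0 : ℝ)..t, r * Real.exp (r * (t - s)) * (∫ u in (0 : ℝ)..s, h u)
      = ∫ s in (0 : ℝ)..t, (Real.exp (r * (t - s)) - 1) * h s := by
  have := integral_deriv_mul_primitive (a := fun s => -Real.exp (-r * s + r * t))
    (a' := fun s => r * Real.exp (-r * s + r * t)) (t := t)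
    (fun x => by
      have := (hasDerivAt_exp_mul (-r) (r * t) x).fun_neg
      rwa [← neg_mul, neg_neg] at this) (by fun_prop) hh
  convert this using 2
  · ext s; ring_nf
  · ext s; ring_nf; simp

/-- A path solving the linear Volterra equation almost everywhere is determined by its
forcing term. -/
theorem volterra_solution {x g : ℝ → ℝ} {T r : ℝ}
    (hx : IntervalIntegrable x volume 0 T)
    (hg : ∀ᵐ s ∂volume, s ∈ uIoc 0 T → x s = g s + r * ∫ u in (0 : ℝ)..s, x u) :
    r * ∫ u in (0 : ℝ)..T, x u = ∫ s in (0 : ℝ)..T, r * Real.exp (r * (T - s)) * g s := by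
  -- Substitute g = x - r∫x under the kernel. The double integral collapses to ∫ (e^{r(T-s)} - 1) x,
  -- the exponential terms cancel, and r∫x remains. The equation is needed only at almost every
  -- time.
  have h1 := integral_exp_mul_primitive r hx
  have h2 : ∫ s in (0 : ℝ)..T, r * Real.exp (r * (T - s)) * g s
      = ∫ s in (0 : ℝ)..T, (r * Real.exp (r * (T - s)) * x s
        - r * (r * Real.exp (r * (T - s)) * ∫ u in (0 : ℝ)..s, x u)) := by
    refine intervalIntegral.integral_congr_ae ?_
    filter_upwards [hg] with s hs hsT
    rw [hs hsT]; ring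
  have hcont : ContinuousOn (fun s => ∫ u in (0 : ℝ)..s, x u) (uIcc 0 T) :=
    intervalIntegral.continuousOn_primitive_interval' hx (by simp)
  have hi1 : IntervalIntegrable (fun s => r * Real.exp (r * (T - s)) * x s) volume 0 T :=
    hx.continuousOn_mul (by fun_prop)
  have hi2 : IntervalIntegrable (fun s => r * (r * Real.exp (r * (T - s)) *
      ∫ u in (0 : ℝ)..s, x u)) volume 0 T :=
    ContinuousOn.intervalIntegrable (by fun_prop)
  rw [h2, intervalIntegral.integral_sub hi1 hi2, intervalIntegral.integral_const_mul, h1]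
  simp only [sub_mul, one_mul]
  rw [intervalIntegral.integral_sub (hx.continuousOn_mul (by fun_prop)) hx]
  have h3 : ∫ s in (0 : ℝ)..T, r * Real.exp (r * (T - s)) * x s
      = r * ∫ s in (0 : ℝ)..T, Real.exp (r * (T - s)) * x s := by
    rw [← intervalIntegral.integral_const_mul]; simp only [mul_assoc]
  rw [h3]; ring

/-- The resolvent formula solves the linear Volterra equation. -/
theorem volterra_resolvent {g : ℝ → ℝ} {t r : ℝ} (hg : IntervalIntegrable g volume 0 t) :
    ∫ s in (0 : ℝ)..t, (g s + r * ∫ u in (0 : ℝ)..s, Real.exp (r * (s - u)) * g u)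
      = ∫ u in (0 : ℝ)..t, Real.exp (r * (t - u)) * g u := by
  have hh : IntervalIntegrable (fun u => Real.exp (-r * u) * g u) volume 0 t :=
    hg.continuousOn_mul (by fun_prop)
  have h1 := integral_deriv_mul_primitive (a := fun s => Real.exp (r * s + 0))
    (a' := fun s => r * Real.exp (r * s + 0)) (t := t)
    (fun x => hasDerivAt_exp_mul r 0 x) (by fun_prop) hh
  have hfac : ∀ s, ∫ u in (0 : ℝ)..s, Real.exp (r * (s - u)) * g u
      = Real.exp (r * s) * ∫ u in (0 : ℝ)..s, Real.exp (-r * u) * g u := fun s => by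
    rw [← intervalIntegral.integral_const_mul]
    congr 1; ext u
    rw [← mul_assoc, ← Real.exp_add]; ring_nf
  have hcont : ContinuousOn (fun s => ∫ u in (0 : ℝ)..s, Real.exp (-r * u) * g u) (uIcc 0 t) :=
    intervalIntegral.continuousOn_primitive_interval' hh (by simp)
  have hi : IntervalIntegrable (fun s => r * ∫ u in (0 : ℝ)..s, Real.exp (r * (s - u)) * g u)
      volume 0 t := by
    simp only [hfac]
    exact ContinuousOn.intervalIntegrable (by fun_prop)
  rw [intervalIntegral.integral_add hg hi]
  have h2 : ∫ s in (0 : ℝ)..t, r * ∫ u in (0 : ℝ)..s, Real.exp (r * (s - u)) * g u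
      = ∫ s in (0 : ℝ)..t, (Real.exp (r * (t - s)) * g s - g s) := by
    simp only [hfac]
    convert h1 using 2
    · ext s; simp [mul_assoc]
    · ext s
      rw [sub_mul, ← mul_assoc, ← mul_assoc, ← Real.exp_add, ← Real.exp_add]
      ring_nf; simp
  rw [h2, intervalIntegral.integral_sub (hg.continuousOn_mul (by fun_prop)) hg]
  ring

end Deterministic

/-! ### Jointly measurable versions of L²-continuous curves -/

section Version

variable {Ω : Type*} [MeasurableSpace Ω] {μ : Measure Ω} [IsProbabilityMeasure μ]

theorem lintegral_enorm_sub_Lp_le (Y Z : Lp ℝ 2 μ) :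
    ∫⁻ ω, ‖Y ω - Z ω‖ₑ ∂μ ≤ ENNReal.ofReal ‖Y - Z‖ := by
  rw [Lp.norm_def, ENNReal.ofReal_toReal (Lp.eLpNorm_ne_top _),
    eLpNorm_congr_ae (Lp.coeFn_sub Y Z)]
  refine le_of_eq_of_le ?_ (eLpNorm_le_eLpNorm_of_exponent_le (p := 1) (by norm_num)
    ((Lp.aestronglyMeasurable Y).sub (Lp.aestronglyMeasurable Z)))
  rw [eLpNorm_one_eq_lintegral_enorm]; rfl

/-- Fast convergence in `L²` implies almost sure convergence. -/
theorem ae_tendsto_of_norm_sub_le {Y : ℕ → Lp ℝ 2 μ} {Z : Lp ℝ 2 μ}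
    (h : ∀ n, ‖Y n - Z‖ ≤ (1 / 2 : ℝ) ^ n) :
    ∀ᵐ ω ∂μ, Tendsto (fun n => Y n ω) atTop (𝓝 (Z ω)) := by
  have hm : ∀ n, AEMeasurable (fun ω => ‖Y n ω - Z ω‖ₑ) μ := fun n =>
    ((Lp.aestronglyMeasurable (Y n)).sub (Lp.aestronglyMeasurable Z)).enorm
  have hsum : ∫⁻ ω, ∑' n, ‖Y n ω - Z ω‖ₑ ∂μ ≠ ∞ := by
    rw [lintegral_tsum hm]
    refine ne_top_of_le_ne_top ?_ (ENNReal.tsum_le_tsum fun n =>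
      (lintegral_enorm_sub_Lp_le (Y n) Z).trans (ENNReal.ofReal_le_ofReal (h n)))
    exact summable_geometric_two.tsum_ofReal_ne_top
  filter_upwards [ae_lt_top' (AEMeasurable.tsum hm) hsum] with ω hω
  have := ENNReal.tendsto_atTop_zero_of_tsum_ne_top hω.ne
  rw [tendsto_iff_edist_tendsto_0]
  simpa [edist_eq_enorm_sub] using this

/-- A continuous curve in `L²` has a jointly measurable version. -/
theorem exists_measurable_version {F : ℝ → Lp ℝ 2 μ} (hF : Continuous F) (T : ℝ) :
    ∃ Z : ℝ → Ω → ℝ, Measurable (Function.uncurry Z) ∧ ∀ t ∈ Icc 0 T, Z t =ᵐ[μ] F t := by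
  have huc := isCompact_Icc.uniformContinuousOn_of_continuous (hF.continuousOn (s := Icc 0 T))
  rw [Metric.uniformContinuousOn_iff] at huc
  choose δ hδ hF' using fun n : ℕ => huc ((1 / 2 : ℝ) ^ n) (by positivity)
  -- Time is rounded down to a grid of mesh δ/2. The rounded process takes values from countably
  -- many L² elements, hence is jointly measurable, and its error 2⁻ⁿ is summable, which forces
  -- almost sure convergence.
  set d : ℕ → ℝ → ℝ := fun n t => ⌊t / (δ n / 2)⌋ * (δ n / 2) with hd
  have hd' : ∀ n, ∀ t ∈ Icc 0 T, d n t ∈ Icc 0 T ∧ dist (d n t) t < δ n := fun n t ht => by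
    have hδ2 : 0 < δ n / 2 := half_pos (hδ n)
    have h0 : 0 ≤ t / (δ n / 2) := div_nonneg ht.1 hδ2.le
    have h1 : d n t ≤ t := by
      rw [hd, ← le_div_iff₀ hδ2]; exact Int.floor_le _
    have h2 : t < d n t + δ n / 2 := by
      have := Int.lt_floor_add_one (t / (δ n / 2))
      rw [div_lt_iff₀ hδ2] at this
      simp only [hd]; linarith
    have h3 : 0 ≤ d n t := mul_nonneg (by exact_mod_cast Int.floor_nonneg.2 h0) hδ2.le
    refine ⟨⟨h3, h1.trans ht.2⟩, ?_⟩
    rw [Real.dist_eq, abs_sub_comm, abs_of_nonneg (by linarith)]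
    linarith [hδ n]
  set Z : ℕ → ℝ → Ω → ℝ := fun n t ω => F (d n t) ω with hZ
  have hZm : ∀ n, Measurable (Function.uncurry (Z n)) := fun n => by
    have h1 : Measurable fun p : ℤ × Ω => F (p.1 * (δ n / 2)) p.2 :=
      measurable_from_prod_countable_right fun i =>
        (Lp.stronglyMeasurable (F (i * (δ n / 2)))).measurable
    have h2 : Measurable fun p : ℝ × Ω => ((⌊p.1 / (δ n / 2)⌋ : ℤ), p.2) :=
      ((measurable_fst.div_const _).floor).prodMk measurable_snd
    exact h1.comp h2
  -- The limsup is jointly measurable even where the limit fails to exist.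
  refine ⟨fun t ω => limsup (fun n => Z n t ω) atTop, Measurable.limsup hZm, fun t ht => ?_⟩
  have := ae_tendsto_of_norm_sub_le (Y := fun n => F (d n t)) (Z := F t) fun n => by
    rw [← dist_eq_norm]
    exact (hF' n _ (hd' n t ht).1 _ ht (hd' n t ht).2).le
  filter_upwards [this] with ω hω
  exact hω.limsup_eq

end Version

/-! ### Truncated and compounded integrands -/

section Truncation

variable {m : ℕ}

/-- The pointwise inner product of two integrands. -/
noncomputable def pairing (g h : Integrands m) (x : ℝ) : ℝ := ∑ k, g k x * h k x

theorem integrable_mul_Lp (f g : Lp ℝ 2 halfLine) :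
    Integrable (fun x => f x * g x) halfLine :=
  (Lp.memLp f).integrable_mul (Lp.memLp g)

theorem integrable_pairing (g h : Integrands m) : Integrable (pairing g h) halfLine :=
  integrable_finsetSum _ fun k _ => integrable_mul_Lp (g k) (h k)

theorem inner_integrands (g h : Integrands m) : inner ℝ g h = ∫ x, pairing g h x ∂halfLine := by
  unfold pairing
  rw [integral_finsetSum _ fun k _ => integrable_mul_Lp (g k) (h k), PiLp.inner_apply]
  refine Finset.sum_congr rfl fun k _ => ?_
  rw [L2.inner_def]
  simp [mul_comm]

/-- The truncation `1_{(0, t]} h` of an integrand. -/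
noncomputable def truncateAll (h : Integrands m) (t : ℝ) : Integrands m :=
  WithLp.toLp 2 fun k => truncate (h k) t

theorem truncateAll_eq_sum (h : Integrands m) (t : ℝ) :
    truncateAll h t = ∑ k, integrandSingle k (truncate (h k) t) :=
  (sum_integrandSingle (truncateAll h t)).symm

theorem pairing_truncateAll (g h : Integrands m) (t : ℝ) :
    pairing g (truncateAll h t) =ᵐ[halfLine] (Ioc 0 t).indicator (pairing g h) := by
  have : ∀ᵐ x ∂halfLine, ∀ k, truncate (h k) t x = (Ioc 0 t).indicator (h k) x :=
    ae_all_iff.2 fun k => coeFn_truncate (h k) t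
  filter_upwards [this] with x hx
  simp only [pairing, truncateAll, hx]
  by_cases hxt : x ∈ Ioc 0 t
  · simp [indicator_of_mem hxt, pairing]
  · simp [indicator_of_notMem hxt]

theorem inner_truncateAll (g h : Integrands m) (t : ℝ) :
    inner ℝ g (truncateAll h t) = ∫ x in Ioc 0 t, pairing g h x := by
  rw [inner_integrands, integral_congr_ae (pairing_truncateAll g h t),
    integral_indicator measurableSet_Ioc, halfLine_restrict_Ioc]

theorem pairing_comm (g h : Integrands m) : pairing g h = pairing h g := by
  ext x; simp [pairing, mul_comm]

theorem inner_truncateAll_truncateAll (h : Integrands m) (s t : ℝ) :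
    inner ℝ (truncateAll h s) (truncateAll h t) = ∫ x in Ioc 0 (min s t), pairing h h x := by
  have h1 : ∀ᵐ x ∂volume.restrict (Ioc 0 t),
      pairing (truncateAll h s) h x = (Ioc 0 s).indicator (pairing h h) x := by
    rw [pairing_comm]
    exact (Measure.restrict_mono_set volume
      (Ioc_subset_Ioi_self : Ioc 0 t ⊆ Ioi 0)).absolutelyContinuous.ae_eq
      (pairing_truncateAll h h s)
  rw [inner_truncateAll, integral_congr_ae h1, setIntegral_indicator measurableSet_Ioc,
    Ioc_inter_Ioc, max_self, min_comm]

theorem continuous_setIntegral_Ioc {u : ℝ → ℝ} (hu : Integrable u halfLine) :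
    Continuous fun t => ∫ x in Ioc 0 t, u x := by
  have hu' : Integrable ((Ioi 0).indicator u) := (integrable_indicator_iff measurableSet_Ioi).2 hu
  have h1 := (hu'.continuous_primitive 0).comp (continuous_id.max (continuous_const (y := (0 : ℝ))))
  convert h1 using 2 with t
  simp only [Function.comp, id]
  rw [intervalIntegral.integral_of_le (le_max_right _ _), setIntegral_indicator measurableSet_Ioi,
    inter_eq_left.2 Ioc_subset_Ioi_self]
  rcases le_total t 0 with ht | ht
  · rw [max_eq_right ht, Ioc_eq_empty (not_lt.2 ht), Ioc_eq_empty (lt_irrefl _)]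
  · rw [max_eq_left ht]

/-- The squared distance between two truncations is an increment of the primitive of |h|². Through
the isometry this makes the Wiener process of `h` an L²-continuous curve, as
`exists_measurable_version` requires. -/
theorem continuous_truncateAll (h : Integrands m) : Continuous (truncateAll h) := by
  have hG := continuous_setIntegral_Ioc (integrable_pairing h h)
  set G : ℝ → ℝ := fun t => ∫ x in Ioc 0 t, pairing h h x
  have hnorm : ∀ s t, ‖truncateAll h t - truncateAll h s‖ ^ 2 = G t + G s - 2 * G (min t s) := by
    intro s t
    rw [norm_sub_sq_real, ← real_inner_self_eq_norm_sq, ← real_inner_self_eq_norm_sq]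
    simp only [inner_truncateAll_truncateAll, min_self, G]
    ring
  refine continuous_iff_continuousAt.2 fun s => ?_
  rw [ContinuousAt, tendsto_iff_norm_sub_tendsto_zero]
  have h0 : Tendsto (fun t => ‖truncateAll h t - truncateAll h s‖ ^ 2) (𝓝 s) (𝓝 0) := by
    simp only [hnorm]
    have : Continuous fun t => G t + G s - 2 * G (min t s) := by fun_prop
    convert this.tendsto s using 2
    simp; ring
  have := h0.sqrt
  simpa [Real.sqrt_sq] using this

theorem norm_truncateAll_le (h : Integrands m) (t : ℝ) : ‖truncateAll h t‖ ≤ ‖h‖ := by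
  refine (sq_le_sq₀ (norm_nonneg _) (norm_nonneg _)).1 ?_
  rw [← real_inner_self_eq_norm_sq, ← real_inner_self_eq_norm_sq, inner_truncateAll_truncateAll,
    min_self, inner_integrands]
  refine setIntegral_mono_set (integrable_pairing h h) (ae_of_all _ fun x => ?_)
    (Eventually.of_forall fun x hx => hx.1)
  exact Finset.sum_nonneg fun k _ => mul_self_nonneg _

theorem memLp_exp_mul (f : Lp ℝ 2 halfLine) (r T : ℝ) :
    MemLp ((Ioc 0 T).indicator fun s => Real.exp (r * (T - s)) * f s) 2 halfLine := by
  refine (Lp.memLp f).of_le_mul (c := Real.exp (|r| * T)) ?_ (ae_of_all _ fun s => ?_)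
  · refine AEStronglyMeasurable.indicator ?_ measurableSet_Ioc
    exact (Continuous.aestronglyMeasurable (by fun_prop)).mul (Lp.aestronglyMeasurable f)
  · by_cases hs : s ∈ Ioc 0 T
    · rw [indicator_of_mem hs, norm_mul, Real.norm_eq_abs, Real.abs_exp]
      refine mul_le_mul_of_nonneg_right (Real.exp_le_exp.2 ?_) (norm_nonneg _)
      calc r * (T - s) ≤ |r| * (T - s) :=
            mul_le_mul_of_nonneg_right (le_abs_self r) (by linarith [hs.2])
        _ ≤ |r| * T := mul_le_mul_of_nonneg_left (by linarith [hs.1]) (abs_nonneg r)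
    · rw [indicator_of_notMem hs, norm_zero]; positivity

/-- The integrand `1_{(0, T]}(s) e^{r (T - s)} h(s)`. -/
noncomputable def compounded (h : Integrands m) (r T : ℝ) : Integrands m :=
  WithLp.toLp 2 fun k => (memLp_exp_mul (h k) r T).toLp _

theorem pairing_compounded (g h : Integrands m) (r T : ℝ) :
    pairing g (compounded h r T) =ᵐ[halfLine]
      (Ioc 0 T).indicator fun s => Real.exp (r * (T - s)) * pairing g h s := by
  have : ∀ᵐ x ∂halfLine, ∀ k, compounded h r T k x
      = (Ioc 0 T).indicator (fun s => Real.exp (r * (T - s)) * h k s) x :=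
    ae_all_iff.2 fun k => (memLp_exp_mul (h k) r T).coeFn_toLp
  filter_upwards [this] with x hx
  simp only [pairing, hx]
  by_cases hxt : x ∈ Ioc 0 T
  · simp only [indicator_of_mem hxt, Finset.mul_sum]
    exact Finset.sum_congr rfl fun k _ => by ring
  · simp [indicator_of_notMem hxt]

theorem inner_compounded (g h : Integrands m) (r T : ℝ) :
    inner ℝ g (compounded h r T) = ∫ s in Ioc 0 T, Real.exp (r * (T - s)) * pairing g h s := by
  rw [inner_integrands, integral_congr_ae (pairing_compounded g h r T),
    integral_indicator measurableSet_Ioc, halfLine_restrict_Ioc]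

theorem norm_compounded_sq (h : Integrands m) (r T : ℝ) :
    ‖compounded h r T‖ ^ 2 = ∫ s in Ioc 0 T, Real.exp (2 * r * (T - s)) * pairing h h s := by
  have h1 : ∀ᵐ x ∂volume.restrict (Ioc 0 T),
      Real.exp (r * (T - x)) * pairing (compounded h r T) h x
        = Real.exp (2 * r * (T - x)) * pairing h h x := by
    rw [pairing_comm, ← halfLine_restrict_Ioc]
    filter_upwards [ae_restrict_of_ae (pairing_compounded h h r T),
      ae_restrict_mem measurableSet_Ioc] with x hx hxT
    rw [hx, indicator_of_mem hxT, ← mul_assoc, ← Real.exp_add]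
    ring_nf
  rw [← real_inner_self_eq_norm_sq, inner_compounded, integral_congr_ae h1]

end Truncation

/-! ### Stochastic Fubini -/

section StochasticFubini

variable {Ω : Type*} [MeasurableSpace Ω] {μ : Measure Ω} [IsProbabilityMeasure μ]
  {m : ℕ} {B : Fin m → ℝ≥0 → Ω → ℝ}

theorem exists_wiener_version (hB : IsStandardBrownian B μ) (h : Integrands m) (T : ℝ) :
    ∃ Z : ℝ → Ω → ℝ, Measurable (Function.uncurry Z) ∧
      ∀ t ∈ Icc 0 T, Z t =ᵐ[μ] wienerMap hB (truncateAll h t) :=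
  exists_measurable_version ((wienerMap hB).continuous.comp (continuous_truncateAll h)) T

variable {hB : IsStandardBrownian B μ} {h : Integrands m} {T : ℝ} {Z : ℝ → Ω → ℝ}

/-- The first absolute moment at each time is at most the L² norm, hence at most ‖h‖, uniformly over
the bounded time interval. -/
theorem integrable_wiener_version (hZm : Measurable (Function.uncurry Z))
    (hZ : ∀ t ∈ Icc 0 T, Z t =ᵐ[μ] wienerMap hB (truncateAll h t)) :
    Integrable (Function.uncurry Z) ((volume.restrict (Icc 0 T)).prod μ) := by
  rw [integrable_prod_iff hZm.aestronglyMeasurable]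
  have hint : ∀ t ∈ Icc 0 T, Integrable (Z t) μ := fun t ht =>
    ((Lp.memLp (wienerMap hB (truncateAll h t))).integrable (by norm_num)).congr (hZ t ht).symm
  refine ⟨(ae_restrict_iff' measurableSet_Icc).2 (ae_of_all _ hint), ?_⟩
  refine Integrable.of_bound (C := ‖h‖) ?_ ?_
  · exact (StronglyMeasurable.integral_prod_right
      (f := fun t ω => ‖Z t ω‖) hZm.norm.stronglyMeasurable).aestronglyMeasurable
  · refine (ae_restrict_iff' measurableSet_Icc).2 (ae_of_all _ fun t ht => ?_)
    rw [Real.norm_of_nonneg (integral_nonneg fun _ => norm_nonneg _)]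
    refine le_trans ?_ ((norm_wienerMap hB _).le.trans (norm_truncateAll_le h t))
    rw [show ∫ ω, ‖Function.uncurry Z (t, ω)‖ ∂μ
        = ∫ ω, ‖wienerMap hB (truncateAll h t) ω‖ ∂μ from
        integral_congr_ae ((hZ t ht).mono fun ω hω => by
          simp only [Function.uncurry]; rw [hω]),
      Lp.norm_def, integral_norm_eq_lintegral_enorm (Lp.aestronglyMeasurable _),
      ← eLpNorm_one_eq_lintegral_enorm]
    exact ENNReal.toReal_mono (Lp.eLpNorm_ne_top _)
      (eLpNorm_le_eLpNorm_of_exponent_le (by norm_num) (Lp.aestronglyMeasurable _))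

/-- Integrals of Wiener integrals over events, through the adjoint of the Wiener operator. -/
theorem exists_setIntegral_wienerMap (hB : IsStandardBrownian B μ) {A : Set Ω}
    (hA : MeasurableSet A) : ∃ g : Integrands m, ∀ h : Integrands m,
      ∫ ω in A, wienerMap hB h ω ∂μ = inner ℝ g h := by
  refine ⟨(wienerMap hB).adjoint (indicatorConstLp 2 hA (measure_ne_top μ A) 1), fun h => ?_⟩
  rw [ContinuousLinearMap.adjoint_inner_left, L2.inner_indicatorConstLp_one]

/-- Compounding a Wiener integral process pathwise compounds its integrand. -/
theorem wiener_version_compounded (hT : 0 ≤ T) (r : ℝ) (hZm : Measurable (Function.uncurry Z))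
    (hZ : ∀ t ∈ Icc 0 T, Z t =ᵐ[μ] wienerMap hB (truncateAll h t)) :
    (fun ω => Z T ω + ∫ s in (0 : ℝ)..T, r * Real.exp (r * (T - s)) * Z s ω)
      =ᵐ[μ] wienerMap hB (compounded h r T) := by
  have hZi := integrable_wiener_version hZm hZ
  have hTm : T ∈ Icc 0 T := ⟨hT, le_rfl⟩
  have hZT : Integrable (Z T) μ :=
    ((Lp.memLp (wienerMap hB (truncateAll h T))).integrable (by norm_num)).congr (hZ T hTm).symm
  have hwi : Integrable (fun p : ℝ × Ω => r * Real.exp (r * (T - p.1)) * Z p.1 p.2)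
      ((volume.restrict (Ioc 0 T)).prod μ) := by
    have hZi' : Integrable (Function.uncurry Z) ((volume.restrict (Ioc 0 T)).prod μ) := by
      rwa [restrict_Ioc_eq_restrict_Icc]
    refine (hZi'.norm.const_mul (|r| * Real.exp (|r| * T))).mono' (by
      refine AEStronglyMeasurable.mul ?_ hZm.aestronglyMeasurable
      exact Measurable.aestronglyMeasurable (by fun_prop)) ?_
    filter_upwards [Measure.quasiMeasurePreserving_fst.ae (ae_restrict_mem measurableSet_Ioc)]
      with p hp
    rw [norm_mul, norm_mul, Real.norm_eq_abs, Real.norm_eq_abs, Real.abs_exp]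
    refine mul_le_mul_of_nonneg_right (mul_le_mul_of_nonneg_left (Real.exp_le_exp.2 ?_)
      (abs_nonneg r)) (norm_nonneg _)
    calc r * (T - p.1) ≤ |r| * (T - p.1) :=
          mul_le_mul_of_nonneg_right (le_abs_self r) (by linarith [hp.2])
      _ ≤ |r| * T := mul_le_mul_of_nonneg_left (by linarith [hp.1]) (abs_nonneg r)
  have hE : Integrable (fun ω => ∫ s in (0 : ℝ)..T, r * Real.exp (r * (T - s)) * Z s ω) μ := by
    simp only [intervalIntegral.integral_of_le hT]
    exact hwi.integral_prod_right
  -- It suffices to compare integrals over events. The adjoint of the Wiener operator turns an event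
  -- into an integrand `g`; after the ordinary Fubini theorem, the claim is integration by parts for
  -- the primitive of `pairing g h`.
  refine Integrable.ae_eq_of_forall_setIntegral_eq _ _ (hZT.add hE)
    ((Lp.memLp _).integrable (by norm_num)) fun A hA _ => ?_
  obtain ⟨g, hg⟩ := exists_setIntegral_wienerMap hB hA
  have hA1 : ∀ s ∈ Icc 0 T, ∫ ω in A, Z s ω ∂μ = ∫ u in (0 : ℝ)..s, pairing g h u := by
    intro s hs
    rw [integral_congr_ae (ae_restrict_of_ae (hZ s hs)), hg, inner_truncateAll,
      intervalIntegral.integral_of_le hs.1]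
  have hpi : IntervalIntegrable (pairing g h) volume 0 T := by
    rw [intervalIntegrable_iff_integrableOn_Ioc_of_le hT, IntegrableOn, ← halfLine_restrict_Ioc]
    exact (integrable_pairing g h).restrict
  have hA2 : ∫ ω in A, (∫ s in (0 : ℝ)..T, r * Real.exp (r * (T - s)) * Z s ω) ∂μ
      = ∫ s in (0 : ℝ)..T, (Real.exp (r * (T - s)) - 1) * pairing g h s := by
    rw [← integral_exp_mul_primitive r hpi]
    simp only [intervalIntegral.integral_of_le hT]
    rw [integral_integral_swap]
    · refine setIntegral_congr_fun measurableSet_Ioc fun s hs => ?_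
      rw [integral_const_mul, hA1 s ⟨hs.1.le, hs.2⟩]
    · have : Integrable (fun p : ℝ × Ω => r * Real.exp (r * (T - p.1)) * Z p.1 p.2)
          ((volume.restrict (Ioc 0 T)).prod (μ.restrict A)) :=
        hwi.mono_measure (Measure.prod_mono le_rfl Measure.restrict_le_self)
      exact this.swap
  rw [integral_add hZT.restrict hE.restrict, hA1 T hTm, hA2, hg, inner_compounded,
    ← intervalIntegral.integral_of_le hT, ← intervalIntegral.integral_add hpi
    (hpi.continuousOn_mul (by fun_prop))]
  refine intervalIntegral.integral_congr fun s _ => ?_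
  ring

end StochasticFubini

/-- The moving upper limit is absorbed into the indicator of a measurable set, leaving an integral
with parameters over a fixed domain. -/
theorem measurable_primitive {Ω : Type*} [MeasurableSpace Ω] {f : ℝ → Ω → ℝ}
    (hf : Measurable (Function.uncurry f)) :
    Measurable fun p : ℝ × Ω => ∫ u in Ioc 0 p.1, f u p.2 := by
  have hS : MeasurableSet {q : (ℝ × Ω) × ℝ | 0 < q.2 ∧ q.2 ≤ q.1.1} :=
    (measurableSet_lt measurable_const measurable_snd).inter
      (measurableSet_le measurable_snd measurable_fst.fst)
  have hF : Measurable fun q : (ℝ × Ω) × ℝ => f q.2 q.1.2 :=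
    hf.comp (measurable_snd.prodMk measurable_fst.snd)
  have := ((hF.indicator hS).stronglyMeasurable.integral_prod_right' (ν := volume)).measurable
  convert this using 2 with p
  rw [← integral_indicator measurableSet_Ioc]
  rfl

/-! ### The wealth process and its terminal law -/

namespace InvestmentGame

variable {m n : ℕ} (G : InvestmentGame m n)

theorem Admissible.eval {p : ℝ → Fin m → ℝ} {G : InvestmentGame m n} (hp : G.Admissible p)
    (i : Fin m) : MemLp (fun s => p s i) 2 (volume.restrict (Ioc 0 G.T)) := by
  have := MemLp.eval hp i
  rwa [← restrict_Ioc_eq_restrict_Icc] at this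

theorem Admissible.memLp_dotProduct {p : ℝ → Fin m → ℝ} {G : InvestmentGame m n}
    (hp : G.Admissible p) (c : Fin m → ℝ) :
    MemLp (fun s => p s ⬝ᵥ c) 2 (volume.restrict (Ioc 0 G.T)) := by
  unfold dotProduct
  refine memLp_finsetSum _ fun i _ => ?_
  simpa [mul_comm] using (hp.eval i).const_mul (c i)

theorem Admissible.memLp_vecMul {p : ℝ → Fin m → ℝ} {G : InvestmentGame m n}
    (hp : G.Admissible p) (k : Fin m) :
    MemLp (fun s => (p s ᵥ* G.σ) k) 2 (volume.restrict (Ioc 0 G.T)) :=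
  hp.memLp_dotProduct fun i => G.σ i k

/-- The volatility `1_{(0, T]} pᵀ σ` of the wealth process. -/
noncomputable def loading {p : ℝ → Fin m → ℝ} (hp : G.Admissible p) : Integrands m :=
  WithLp.toLp 2 fun k => ((memLp_indicator_Ioc_iff _ _).2 (hp.memLp_vecMul k)).toLp _

variable {G} {p : ℝ → Fin m → ℝ} (hp : G.Admissible p)

theorem loading_ae_eq {t : ℝ} (ht : t ≤ G.T) (k : Fin m) :
    G.loading hp k =ᵐ[volume.restrict (Ioc 0 t)] fun s => (p s ᵥ* G.σ) k := by
  have h1 : G.loading hp k =ᵐ[halfLine] _ :=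
    MemLp.coeFn_toLp ((memLp_indicator_Ioc_iff _ _).2 (hp.memLp_vecMul k))
  rw [← halfLine_restrict_Ioc]
  filter_upwards [ae_restrict_of_ae h1, ae_restrict_mem measurableSet_Ioc] with s hs hst
  rw [hs, indicator_of_mem (show s ∈ Ioc 0 G.T from ⟨hst.1, hst.2.trans ht⟩)]

theorem pairing_loading :
    pairing (G.loading hp) (G.loading hp) =ᵐ[volume.restrict (Ioc 0 G.T)]
      fun s => p s ⬝ᵥ (G.cov *ᵥ p s) := by
  have : ∀ᵐ s ∂volume.restrict (Ioc 0 G.T), ∀ k, G.loading hp k s = (p s ᵥ* G.σ) k :=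
    ae_all_iff.2 fun k => loading_ae_eq hp le_rfl k
  filter_upwards [this] with s hs
  simp only [pairing, hs]
  rw [cov, ← Matrix.mulVec_mulVec, Matrix.dotProduct_mulVec, Matrix.mulVec_transpose]
  rfl

/-- The excess return `∫_0^t pᵀ v ds` plus the initial wealth. -/
noncomputable def drift (G : InvestmentGame m n) (j : Fin n) (p : ℝ → Fin m → ℝ) (t : ℝ) : ℝ :=
  G.x j + ∫ s in Ioc 0 t, (Ioc 0 G.T).indicator (fun s => p s ⬝ᵥ G.v) s

theorem continuous_drift (hp : G.Admissible p) (j : Fin n) : Continuous (G.drift j p) := by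
  have h1 : Integrable ((Ioc 0 G.T).indicator fun s => p s ⬝ᵥ G.v) halfLine := by
    rw [integrable_indicator_iff measurableSet_Ioc, IntegrableOn, halfLine_restrict_Ioc]
    exact (hp.memLp_dotProduct G.v).integrable (by norm_num)
  exact continuous_const.add (continuous_setIntegral_Ioc h1)

theorem drift_eq (G : InvestmentGame m n) (j : Fin n) (p : ℝ → Fin m → ℝ) {t : ℝ} (h0 : 0 ≤ t)
    (ht : t ≤ G.T) : G.drift j p t = G.x j + ∫ s in (0 : ℝ)..t, p s ⬝ᵥ G.v := by
  rw [drift, setIntegral_indicator measurableSet_Ioc, intervalIntegral.integral_of_le h0,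
    inter_eq_left.2 (Ioc_subset_Ioc_right ht)]

theorem Admissible.intervalIntegrable_dotProduct (hp : G.Admissible p) (c : Fin m → ℝ) :
    IntervalIntegrable (fun s => p s ⬝ᵥ c) volume 0 G.T := by
  rw [intervalIntegrable_iff_integrableOn_Ioc_of_le G.T_pos.le]
  exact (hp.memLp_dotProduct c).integrable (by norm_num)

/-- Deterministic counterpart of `wiener_version_compounded`: together they evaluate the pathwise
Volterra solution with forcing term drift plus noise. -/
theorem compounded_drift (hp : G.Admissible p) (j : Fin n) :
    G.drift j p G.T + ∫ s in (0 : ℝ)..G.T, G.r * Real.exp (G.r * (G.T - s)) * G.drift j p s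
      = G.x j * Real.exp (G.r * G.T)
        + ∫ s in (0 : ℝ)..G.T, Real.exp (G.r * (G.T - s)) * (G.v ⬝ᵥ p s) := by
  have hi := hp.intervalIntegrable_dotProduct G.v
  have h1 : ∫ s in (0 : ℝ)..G.T, G.r * Real.exp (G.r * (G.T - s)) * G.drift j p s
      = ∫ s in (0 : ℝ)..G.T, (G.r * Real.exp (G.r * (G.T - s)) * G.x j
        + G.r * Real.exp (G.r * (G.T - s)) * ∫ u in (0 : ℝ)..s, p u ⬝ᵥ G.v) := by
    refine intervalIntegral.integral_congr fun s hs => ?_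
    rw [uIcc_of_le G.T_pos.le] at hs
    simp only [drift_eq G j p hs.1 hs.2]
    ring
  have hcont : ContinuousOn (fun s => ∫ u in (0 : ℝ)..s, p u ⬝ᵥ G.v) (uIcc 0 G.T) :=
    intervalIntegral.continuousOn_primitive_interval' hi (by simp)
  have h2 : ∫ s in (0 : ℝ)..G.T, G.r * Real.exp (G.r * (G.T - s)) * G.x j
      = (Real.exp (G.r * G.T) - 1) * G.x j := by
    rw [intervalIntegral.integral_mul_const]
    congr 1
    have := intervalIntegral.integral_eq_sub_of_hasDerivAt (a := 0) (b := G.T)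
      (f := fun s => -Real.exp (-G.r * s + G.r * G.T))
      (f' := fun s => G.r * Real.exp (G.r * (G.T - s))) (fun s _ => by
        have := (hasDerivAt_exp_mul (-G.r) (G.r * G.T) s).fun_neg
        rw [← neg_mul, neg_neg] at this
        convert this using 3; ring) (ContinuousOn.intervalIntegrable (by fun_prop))
    rw [this]
    ring_nf
    simp
  rw [h1, intervalIntegral.integral_add (ContinuousOn.intervalIntegrable (by fun_prop))
    (ContinuousOn.intervalIntegrable (by fun_prop)), h2, integral_exp_mul_primitive G.r hi,
    drift_eq G j p G.T_pos.le le_rfl]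
  simp only [sub_mul, one_mul]
  rw [intervalIntegral.integral_sub (hi.continuousOn_mul (by fun_prop)) hi]
  simp only [dotProduct_comm G.v]
  ring

section Wealth

variable {Ω : Type*} [MeasurableSpace Ω] {μ : Measure Ω}
  {B : Fin m → ℝ≥0 → Ω → ℝ}

theorem sum_wienerMap_integrandSingle (hB : IsStandardBrownian B μ) (h : Integrands m) (t : ℝ) :
    (fun ω => ∑ k, wienerMap hB (integrandSingle k (truncate (h k) t)) ω)
      =ᵐ[μ] wienerMap hB (truncateAll h t) := by
  rw [truncateAll_eq_sum, map_sum]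
  filter_upwards [Lp.coeFn_finsetSum Finset.univ
    fun k => wienerMap hB (integrandSingle k (truncate (h k) t))] with ω hω
  rw [hω, Finset.sum_apply]

variable [IsProbabilityMeasure μ]

/-- The arbitrary Wiener integrals of the definition are replaced by operator values. The
exceptional null set still depends on t. -/
theorem IsWealth.ae_eq (hB : IsStandardBrownian B μ) {j : Fin n} {X : ℝ → Ω → ℝ}
    (hX : G.IsWealth B μ j p X) {t : ℝ} (h0 : 0 ≤ t) (ht : t ≤ G.T) :
    ∀ᵐ ω ∂μ, X t ω = G.drift j p t + G.r * (∫ s in (0 : ℝ)..t, X s ω)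
      + wienerMap hB (truncateAll (G.loading hp) t) ω := by
  lift t to ℝ≥0 using h0
  obtain ⟨Y, hY, hXt⟩ := hX.equation t ht
  have hYk : ∀ᵐ ω ∂μ, ∀ k, Y k ω
      = wienerMap hB (integrandSingle k (truncate (G.loading hp k) t)) ω :=
    ae_all_iff.2 fun k => (hY k).ae_eq hB (loading_ae_eq hp ht k)
  filter_upwards [hXt, hYk, sum_wienerMap_integrandSingle hB (G.loading hp) t, hX.integrable]
    with ω h1 h2 h3 h4
  have hXi : IntervalIntegrable (fun s => X s ω) volume 0 t := by
    rw [intervalIntegrable_iff_integrableOn_Icc_of_le t.coe_nonneg]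
    exact h4.mono_set (Icc_subset_Icc_right ht)
  have hpi : IntervalIntegrable (fun s => p s ⬝ᵥ G.v) volume 0 t :=
    (hp.intervalIntegrable_dotProduct G.v).mono_set (by
      rw [uIcc_of_le t.coe_nonneg, uIcc_of_le G.T_pos.le]; exact Icc_subset_Icc_right ht)
  rw [h1, ← h3, drift_eq G j p t.coe_nonneg ht, intervalIntegral.integral_add (hXi.const_mul _) hpi,
    intervalIntegral.integral_const_mul]
  simp only [h2]
  ring

/-- For almost every path, the wealth equation holds at almost every time. -/
theorem IsWealth.ae_ae_eq (hB : IsStandardBrownian B μ) {j : Fin n} {X : ℝ → Ω → ℝ}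
    (hX : G.IsWealth B μ j p X) {Z : ℝ → Ω → ℝ} (hZm : Measurable (Function.uncurry Z))
    (hZ : ∀ t ∈ Icc 0 G.T, Z t =ᵐ[μ] wienerMap hB (truncateAll (G.loading hp) t)) :
    ∀ᵐ ω ∂μ, ∀ᵐ s ∂volume.restrict (Icc 0 G.T),
      X s ω = G.drift j p s + Z s ω + G.r * ∫ u in (0 : ℝ)..s, X u ω := by
  set ν := volume.restrict (Icc 0 G.T)
  -- Exchanging "almost every time" with "almost every path" needs a measurable set, hence a
  -- measurable representative of `X`. For almost every path both have the same primitive at all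
  -- times.
  obtain ⟨X', hX'm, hXX'⟩ := hX.measurable
  have hcol : ∀ᵐ s ∂ν, ∀ᵐ ω ∂μ, X s ω = X' (s, ω) := Measure.ae_ae_of_ae_prod hXX'
  have hrow : ∀ᵐ ω ∂μ, ∀ᵐ s ∂ν, X s ω = X' (s, ω) := by
    refine Measure.ae_ae_of_ae_prod (p := fun q : Ω × ℝ => X q.2 q.1 = X' (q.2, q.1)) ?_
    exact (Measure.measurePreserving_swap (μ := μ) (ν := ν)).quasiMeasurePreserving.ae hXX'
  have hprim : ∀ᵐ ω ∂μ, ∀ s ∈ Icc 0 G.T,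
      ∫ u in (0 : ℝ)..s, X u ω = ∫ u in Ioc 0 s, X' (u, ω) := by
    filter_upwards [hrow] with ω hω s hs
    rw [intervalIntegral.integral_of_le hs.1]
    refine integral_congr_ae ?_
    exact (Measure.restrict_mono_set volume (Ioc_subset_Icc_self.trans
      (Icc_subset_Icc_right hs.2))).absolutelyContinuous.ae_le hω
  have hPm : Measurable fun q : ℝ × Ω => ∫ u in Ioc 0 q.1, X' (u, q.2) :=
    measurable_primitive (f := fun u ω => X' (u, ω)) hX'm
  have hdm : Measurable (G.drift j p) := (continuous_drift hp j).measurable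
  have hset : MeasurableSet {q : ℝ × Ω | X' q
      = G.drift j p q.1 + Z q.1 q.2 + G.r * ∫ u in Ioc 0 q.1, X' (u, q.2)} :=
    measurableSet_eq_fun hX'm
      (((hdm.comp measurable_fst).add hZm).add (hPm.const_mul _))
  have hmain : ∀ᵐ s ∂ν, ∀ᵐ ω ∂μ, X' (s, ω)
      = G.drift j p s + Z s ω + G.r * ∫ u in Ioc 0 s, X' (u, ω) := by
    filter_upwards [hcol, ae_restrict_mem measurableSet_Icc] with s hs hsT
    filter_upwards [hs, hprim, hX.ae_eq hp hB hsT.1 hsT.2, hZ s hsT] with ω h1 h2 h3 h4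
    rw [← h1, ← h2 s hsT, h3, h4]
    ring
  have hswap := (Measure.ae_ae_comm (p := fun s ω => X' (s, ω)
      = G.drift j p s + Z s ω + G.r * ∫ u in Ioc 0 s, X' (u, ω)) hset).1 hmain
  filter_upwards [hswap, hrow, hprim] with ω h1 h2 h3
  filter_upwards [h1, h2, ae_restrict_mem measurableSet_Icc] with s h4 h5 h6
  rw [h5, h4, h3 s h6]

/-- The deterministic part of the terminal wealth. -/
noncomputable def terminalMean (G : InvestmentGame m n) (j : Fin n) (p : ℝ → Fin m → ℝ) : ℝ :=
  G.x j * Real.exp (G.r * G.T)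
    + ∫ s in (0 : ℝ)..G.T, Real.exp (G.r * (G.T - s)) * (G.v ⬝ᵥ p s)

/-- The terminal wealth is Gaussian: its mean plus a Wiener integral. -/
theorem IsWealth.terminal_ae_eq (hB : IsStandardBrownian B μ) {j : Fin n} {X : ℝ → Ω → ℝ}
    (hX : G.IsWealth B μ j p X) :
    ∀ᵐ ω ∂μ, X G.T ω = G.terminalMean j p
      + wienerMap hB (compounded (G.loading hp) G.r G.T) ω := by
  obtain ⟨Z, hZm, hZ⟩ := exists_wiener_version hB (G.loading hp) G.T
  have hT : G.T ∈ Icc 0 G.T := ⟨G.T_pos.le, le_rfl⟩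
  filter_upwards [hX.ae_ae_eq hp hB hZm hZ, hX.ae_eq hp hB hT.1 hT.2, hZ G.T hT, hX.integrable,
    (integrable_wiener_version hZm hZ).prod_left_ae,
    wiener_version_compounded G.T_pos.le G.r hZm hZ] with ω h1 h2 h3 h4 h5 h6
  have hXi : IntervalIntegrable (fun s => X s ω) volume 0 G.T :=
    (intervalIntegrable_iff_integrableOn_Icc_of_le G.T_pos.le).2 h4
  have hZi : IntervalIntegrable (fun s => Z s ω) volume 0 G.T :=
    (intervalIntegrable_iff_integrableOn_Icc_of_le G.T_pos.le).2 h5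
  have hdc := continuous_drift hp j
  -- The equation at almost every time determines r∫X; the equation at time T itself, `h2`, then
  -- gives the terminal value.
  have h7 := volterra_solution (g := fun s => G.drift j p s + Z s ω) (r := G.r) hXi (by
    rw [ae_restrict_iff' measurableSet_Icc] at h1
    filter_upwards [h1] with s hs hsT
    rw [uIoc_of_le G.T_pos.le] at hsT
    exact hs ⟨hsT.1.le, hsT.2⟩)
  simp only [mul_add] at h7
  rw [intervalIntegral.integral_add (Continuous.intervalIntegrable (by fun_prop) _ _)
    (hZi.continuousOn_mul (by fun_prop))] at h7
  rw [h2, h7, ← h6, terminalMean, ← compounded_drift hp j, h3]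
  ring

/-- Every admissible strategy has a wealth process. -/
theorem exists_isWealth (hB : IsStandardBrownian B μ) (hp : G.Admissible p) (j : Fin n) :
    ∃ X : ℝ → Ω → ℝ, G.IsWealth B μ j p X := by
  obtain ⟨Z, hZm, hZ⟩ := exists_wiener_version hB (G.loading hp) G.T
  have hdc := continuous_drift hp j
  have hgm : Measurable (Function.uncurry fun s ω => G.drift j p s + Z s ω) :=
    (hdc.measurable.comp measurable_fst).add hZm
  have hgi : ∀ᵐ ω ∂μ, IntervalIntegrable (fun s => G.drift j p s + Z s ω) volume 0 G.T := by
    filter_upwards [(integrable_wiener_version hZm hZ).prod_left_ae] with ω h5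
    exact (hdc.intervalIntegrable _ _).add
      ((intervalIntegrable_iff_integrableOn_Icc_of_le G.T_pos.le).2 h5)
  -- Splitting the kernel frees the integrand of t, so that measurability and continuity in t reduce
  -- to those of a primitive.
  have hsplit : ∀ t ω, 0 ≤ t →
      ∫ u in (0 : ℝ)..t, Real.exp (G.r * (t - u)) * (G.drift j p u + Z u ω)
      = Real.exp (G.r * t) *
        ∫ u in Ioc 0 t, Real.exp (-G.r * u) * (G.drift j p u + Z u ω) := fun t ω ht => by
    rw [intervalIntegral.integral_of_le ht, ← integral_const_mul]
    congr 1; ext u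
    rw [← mul_assoc, ← Real.exp_add]; ring_nf
  -- Variation of constants: the resolvent formula with forcing term drift plus noise.
  set X : ℝ → Ω → ℝ := fun t ω => (G.drift j p t + Z t ω) + G.r * (Real.exp (G.r * t) *
        ∫ u in Ioc 0 t, Real.exp (-G.r * u) * (G.drift j p u + Z u ω)) with hXdef
  have hXeq : ∀ t ω, 0 ≤ t → X t ω = (G.drift j p t + Z t ω)
      + G.r * ∫ u in (0 : ℝ)..t, Real.exp (G.r * (t - u)) * (G.drift j p u + Z u ω) :=
    fun t ω ht => by rw [hsplit t ω ht]
  have hXi : ∀ᵐ ω ∂μ, IntervalIntegrable (fun s => X s ω) volume 0 G.T := by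
    filter_upwards [hgi] with ω hω
    have h1 : ContinuousOn (fun s => ∫ u in (0 : ℝ)..s,
        Real.exp (-G.r * u) * (G.drift j p u + Z u ω)) (uIcc 0 G.T) :=
      intervalIntegral.continuousOn_primitive_interval'
        (hω.continuousOn_mul (by fun_prop)) (by simp)
    have h2 : ContinuousOn (fun s => G.r * (Real.exp (G.r * s) * ∫ u in (0 : ℝ)..s,
        Real.exp (-G.r * u) * (G.drift j p u + Z u ω))) (uIcc 0 G.T) := by fun_prop
    refine (hω.add h2.intervalIntegrable).congr fun s hs => ?_
    rw [uIoc_of_le G.T_pos.le] at hs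
    simp only [hXdef, intervalIntegral.integral_of_le hs.1.le]
  refine ⟨X, ?_, ?_, ?_⟩
  · have h1 : Measurable fun q : ℝ × Ω => ∫ u in Ioc 0 q.1,
        Real.exp (-G.r * u) * (G.drift j p u + Z u q.2) := by
      refine measurable_primitive (f := fun u ω => Real.exp (-G.r * u) *
        (G.drift j p u + Z u ω)) (Measurable.mul ?_ hgm)
      exact Measurable.comp (g := fun u : ℝ => Real.exp (-G.r * u)) (by fun_prop) measurable_fst
    have h2 : Measurable fun q : ℝ × Ω => Real.exp (G.r * q.1) := by fun_prop
    exact (hgm.add ((h2.mul h1).const_mul G.r)).aemeasurable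
  · filter_upwards [hXi] with ω hω
    exact (intervalIntegrable_iff_integrableOn_Icc_of_le G.T_pos.le).1 hω
  · intro t ht
    refine ⟨fun k => wienerMap hB (integrandSingle k (truncate (G.loading hp k) t)), fun k =>
      isWienerIntegral_of_ae_eq hB (loading_ae_eq hp ht k) EventuallyEq.rfl, ?_⟩
    filter_upwards [hgi, hXi, sum_wienerMap_integrandSingle hB (G.loading hp) t,
      hZ t ⟨t.coe_nonneg, ht⟩] with ω h1 h2 h3 h4
    have hsub : uIcc 0 (t : ℝ) ⊆ uIcc 0 G.T := by
      rw [uIcc_of_le t.coe_nonneg, uIcc_of_le G.T_pos.le]; exact Icc_subset_Icc_right ht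
    have hres := volterra_resolvent (r := G.r) (h1.mono_set hsub)
    have hint : ∫ s in (0 : ℝ)..t, X s ω
        = ∫ u in (0 : ℝ)..t, Real.exp (G.r * (t - u)) * (G.drift j p u + Z u ω) := by
      rw [← hres]
      refine intervalIntegral.integral_congr fun s hs => ?_
      rw [uIcc_of_le t.coe_nonneg] at hs
      exact hXeq s ω hs.1
    rw [h3, hXeq t ω t.coe_nonneg, ← hint, intervalIntegral.integral_add
      ((h2.mono_set hsub).const_mul _) ((hp.intervalIntegrable_dotProduct G.v).mono_set hsub),
      intervalIntegral.integral_const_mul, drift_eq G j p t.coe_nonneg ht, h4]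
    ring

theorem utility_terminal (hB : IsStandardBrownian B μ) (hp : G.Admissible p) {j : Fin n}
    {X : ℝ → Ω → ℝ} (hX : G.IsWealth B μ j p X) :
    (fun ω => G.utility j (X G.T ω)) =ᵐ[μ] fun ω =>
      (-(G.α j)⁻¹ * Real.exp (-G.α j * G.terminalMean j p)) *
        Real.exp (-G.α j * wienerMap hB (compounded (G.loading hp) G.r G.T) ω) := by
  filter_upwards [hX.terminal_ae_eq hp hB] with ω hω
  rw [utility, hω, mul_assoc, ← Real.exp_add, mul_add]

theorem IsWealth.integrable_utility (hB : IsStandardBrownian B μ) (hp : G.Admissible p) {j : Fin n}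
    {X : ℝ → Ω → ℝ} (hX : G.IsWealth B μ j p X) :
    Integrable (fun ω => G.utility j (X G.T ω)) μ :=
  ((integrable_exp_wienerMap hB _ _).const_mul _).congr (utility_terminal hB hp hX).symm

/-- The expected utility of the terminal wealth. -/
theorem IsWealth.integral_utility (hB : IsStandardBrownian B μ) (hp : G.Admissible p) {j : Fin n}
    {X : ℝ → Ω → ℝ} (hX : G.IsWealth B μ j p X) :
    ∫ ω, G.utility j (X G.T ω) ∂μ = -(G.α j)⁻¹ * G.eta j p := by
  rw [integral_congr_ae (utility_terminal hB hp hX), integral_const_mul, integral_exp_wienerMap,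
    mul_assoc, ← Real.exp_add, eta, norm_compounded_sq, terminalMean]
  have h1 : ∫ s in Ioc 0 G.T, Real.exp (2 * G.r * (G.T - s)) *
        pairing (G.loading hp) (G.loading hp) s
      = ∫ t in (0 : ℝ)..G.T, Real.exp (2 * G.r * (G.T - t)) * (p t ⬝ᵥ (G.cov *ᵥ p t)) := by
    rw [intervalIntegral.integral_of_le G.T_pos.le]
    refine integral_congr_ae ?_
    filter_upwards [pairing_loading hp] with s hs
    rw [hs]
  rw [h1]
  congr 2
  ring

end Wealth

end InvestmentGame

/-! ### The payoff as a concave functional of the strategy -/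

theorem real_dotProduct_self_nonneg {ι : Type*} [Fintype ι] (a : ι → ℝ) : 0 ≤ a ⬝ᵥ a :=
  Finset.sum_nonneg fun i _ => mul_self_nonneg (a i)

namespace InvestmentGame

variable {m n : ℕ} {G : InvestmentGame m n}

section Admissible

variable {a b : ℝ → Fin m → ℝ}

theorem Admissible.add (ha : G.Admissible a) (hb : G.Admissible b) : G.Admissible (a + b) :=
  MemLp.add ha hb

theorem Admissible.sub (ha : G.Admissible a) (hb : G.Admissible b) : G.Admissible (a - b) :=
  MemLp.sub ha hb

theorem Admissible.smul (ha : G.Admissible a) (c : ℝ) : G.Admissible (c • a) :=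
  MemLp.const_smul ha c

theorem Admissible.mulVec (ha : G.Admissible a) (A : Matrix (Fin m) (Fin m) ℝ) :
    G.Admissible fun t => A *ᵥ a t := by
  refine MemLp.of_eval fun i => ?_
  simp only [Matrix.mulVec, dotProduct]
  exact memLp_finsetSum _ fun k _ => (MemLp.eval ha k).const_mul (A i k)

theorem admissible_of_continuous (ha : Continuous a) : G.Admissible a := by
  obtain ⟨C, hC⟩ := (isCompact_Icc (a := 0) (b := G.T)).exists_bound_of_continuousOn
    ha.continuousOn
  exact MemLp.of_bound ha.aestronglyMeasurable C
    ((ae_restrict_iff' measurableSet_Icc).2 (ae_of_all _ hC))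

theorem admissible_followees {P : Fin n → ℝ → Fin m → ℝ} (hP : ∀ j, G.Admissible (P j))
    (j : Fin n) : G.Admissible (G.followees P j) :=
  memLp_finsetSum _ fun i _ => MemLp.const_smul (hP i) (G.W j i)

end Admissible

/-- The compounded `L²` inner product of strategies. -/
noncomputable def strategyInner (G : InvestmentGame m n) (a b : ℝ → Fin m → ℝ) : ℝ :=
  ∫ t in (0 : ℝ)..G.T, Real.exp (2 * G.r * (G.T - t)) * (a t ⬝ᵥ b t)

section StrategyInner

variable {a b c : ℝ → Fin m → ℝ}

theorem intervalIntegrable_strategyInner (ha : G.Admissible a) (hb : G.Admissible b) :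
    IntervalIntegrable (fun t => Real.exp (2 * G.r * (G.T - t)) * (a t ⬝ᵥ b t)) volume 0 G.T := by
  refine IntervalIntegrable.continuousOn_mul ?_ (by fun_prop)
  rw [intervalIntegrable_iff_integrableOn_Ioc_of_le G.T_pos.le]
  exact integrable_finsetSum _ fun i _ => (ha.eval i).integrable_mul (hb.eval i)

theorem strategyInner_comm (a b : ℝ → Fin m → ℝ) :
    G.strategyInner a b = G.strategyInner b a := by
  simp only [strategyInner, dotProduct_comm]

theorem strategyInner_add_left (ha : G.Admissible a) (hb : G.Admissible b)
    (hc : G.Admissible c) :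
    G.strategyInner (a + b) c = G.strategyInner a c + G.strategyInner b c := by
  simp only [strategyInner]
  rw [← intervalIntegral.integral_add (intervalIntegrable_strategyInner ha hc)
    (intervalIntegrable_strategyInner hb hc)]
  simp only [Pi.add_apply, add_dotProduct, mul_add]

theorem strategyInner_smul_left (s : ℝ) (a b : ℝ → Fin m → ℝ) :
    G.strategyInner (s • a) b = s * G.strategyInner a b := by
  simp only [strategyInner]
  rw [← intervalIntegral.integral_const_mul]
  simp only [Pi.smul_apply, smul_dotProduct, smul_eq_mul]
  congr 1; ext t; ring

theorem strategyInner_sub_left (ha : G.Admissible a) (hb : G.Admissible b)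
    (hc : G.Admissible c) :
    G.strategyInner (a - b) c = G.strategyInner a c - G.strategyInner b c := by
  have h := strategyInner_add_left ha (hb.smul (-1)) hc
  rw [strategyInner_smul_left] at h
  rw [show a - b = a + (-1 : ℝ) • b by simp [sub_eq_add_neg], h]
  ring

theorem strategyInner_self_nonneg (a : ℝ → Fin m → ℝ) : 0 ≤ G.strategyInner a a :=
  intervalIntegral.integral_nonneg G.T_pos.le fun t _ =>
    mul_nonneg (Real.exp_pos _).le (real_dotProduct_self_nonneg (a t))

theorem ae_eq_zero_of_strategyInner_self (ha : G.Admissible a)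
    (h : G.strategyInner a a = 0) : ∀ᵐ t ∂volume.restrict (Icc 0 G.T), a t = 0 := by
  rw [strategyInner, intervalIntegral.integral_of_le G.T_pos.le, integral_eq_zero_iff_of_nonneg
    (fun t => mul_nonneg (Real.exp_pos _).le (real_dotProduct_self_nonneg (a t)))
    ((intervalIntegrable_iff_integrableOn_Ioc_of_le G.T_pos.le).1
      (intervalIntegrable_strategyInner ha ha))] at h
  rw [← restrict_Ioc_eq_restrict_Icc]
  filter_upwards [h] with t ht
  have := (mul_eq_zero.1 ht).resolve_left (Real.exp_pos _).ne'
  exact dotProduct_self_eq_zero.1 this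

theorem strategyInner_eq_zero_of_ae (h : ∀ᵐ t ∂volume.restrict (Icc 0 G.T), a t = 0) :
    G.strategyInner a b = 0 := by
  rw [strategyInner, intervalIntegral.integral_of_le G.T_pos.le]
  rw [← restrict_Ioc_eq_restrict_Icc] at h
  refine integral_eq_zero_of_ae ?_
  filter_upwards [h] with t ht
  simp [ht]

end StrategyInner

theorem cov_transpose (G : InvestmentGame m n) : G.covᵀ = G.cov := by
  rw [cov, Matrix.transpose_mul, Matrix.transpose_transpose]

theorem strategyInner_cov_comm (a b : ℝ → Fin m → ℝ) :
    G.strategyInner (fun t => G.cov *ᵥ a t) b = G.strategyInner (fun t => G.cov *ᵥ b t) a := by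
  simp only [strategyInner]
  congr 1; ext t
  rw [dotProduct_comm, Matrix.dotProduct_mulVec, ← Matrix.mulVec_transpose, cov_transpose]

theorem strategyInner_cov_self_nonneg (a : ℝ → Fin m → ℝ) :
    0 ≤ G.strategyInner (fun t => G.cov *ᵥ a t) a := by
  refine intervalIntegral.integral_nonneg G.T_pos.le fun t _ =>
    mul_nonneg (Real.exp_pos _).le ?_
  change 0 ≤ (G.cov *ᵥ a t) ⬝ᵥ a t
  rw [dotProduct_comm, cov, ← Matrix.mulVec_mulVec, Matrix.dotProduct_mulVec,
    Matrix.mulVec_transpose]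
  exact real_dotProduct_self_nonneg _

/-- The discounted excess return vector. -/
noncomputable def discountedReturn (G : InvestmentGame m n) (t : ℝ) : Fin m → ℝ :=
  Real.exp (G.r * (t - G.T)) • G.v

theorem admissible_discountedReturn : G.Admissible G.discountedReturn :=
  admissible_of_continuous (by unfold discountedReturn; fun_prop)

/-- The exponent becomes affine plus quadratic in one inner product: the discount e^{r(t-T)} turns
the weight e^{2r(T-t)} into e^{r(T-t)}. -/
theorem eta_eq (j : Fin n) (p : ℝ → Fin m → ℝ) :
    G.eta j p = Real.exp (-G.α j * G.x j * Real.exp (G.r * G.T)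
      - G.α j * G.strategyInner G.discountedReturn p
      + (G.α j) ^ 2 / 2 * G.strategyInner (fun t => G.cov *ᵥ p t) p) := by
  have h1 : G.strategyInner G.discountedReturn p
      = ∫ t in (0 : ℝ)..G.T, Real.exp (G.r * (G.T - t)) * (G.v ⬝ᵥ p t) := by
    simp only [strategyInner, discountedReturn, smul_dotProduct, smul_eq_mul]
    congr 1; ext t
    rw [← mul_assoc, ← Real.exp_add]; ring_nf
  rw [eta, h1, strategyInner]
  simp only [dotProduct_comm]

/-- The objective as a function of the strategy alone. -/
noncomputable def payoff (G : InvestmentGame m n) (j : Fin n) (q p : ℝ → Fin m → ℝ) : ℝ :=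
  -(G.α j)⁻¹ * G.eta j p - G.θ j * G.deviation p q

/-- Every admissible strategy has a wealth process, its utility is always integrable, and the
objective is the same for all its wealth processes; the quantifiers over `X` therefore disappear. -/
theorem isOptimalAgainst_iff {Ω : Type*} [MeasurableSpace Ω] {μ : Measure Ω}
    [IsProbabilityMeasure μ] {B : Fin m → ℝ≥0 → Ω → ℝ} (hB : IsStandardBrownian B μ)
    {j : Fin n} {q p : ℝ → Fin m → ℝ} (hp : G.Admissible p) :
    G.IsOptimalAgainst B μ j q p ↔
      ∀ p', G.Admissible p' → G.payoff j q p' ≤ G.payoff j q p := by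
  have hobj : ∀ (p : ℝ → Fin m → ℝ) (X : ℝ → Ω → ℝ), G.Admissible p → G.IsWealth B μ j p X →
      G.objective μ j X p q = G.payoff j q p := fun p X hp hX => by
    rw [objective, payoff, hX.integral_utility hB hp]
  constructor
  · rintro ⟨-, X, hX, -, hmax⟩ p' hp'
    obtain ⟨X', hX'⟩ := exists_isWealth hB hp' j
    have := hmax p' X' hp' hX' (hX'.integrable_utility hB hp')
    rwa [hobj p' X' hp' hX', hobj p X hp hX] at this
  · intro h
    obtain ⟨X, hX⟩ := exists_isWealth hB hp j
    refine ⟨hp, X, hX, hX.integrable_utility hB hp, fun p' X' hp' hX' _ => ?_⟩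
    rw [hobj p' X' hp' hX', hobj p X hp hX]
    exact h p' hp'

/-- The gradient of the payoff at `p`. -/
noncomputable def gradient (G : InvestmentGame m n) (j : Fin n) (q p : ℝ → Fin m → ℝ) :
    ℝ → Fin m → ℝ :=
  G.eta j p • G.discountedReturn - (G.α j * G.eta j p) • (fun t => G.cov *ᵥ p t)
    - G.θ j • (p - q)

section Variation

variable {q p h : ℝ → Fin m → ℝ}

theorem admissible_gradient (hp : G.Admissible p) (hq : G.Admissible q) (j : Fin n) :
    G.Admissible (G.gradient j q p) :=
  ((admissible_discountedReturn.smul _).sub ((hp.mulVec _).smul _)).sub ((hp.sub hq).smul _)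

theorem strategyInner_gradient (hp : G.Admissible p) (hq : G.Admissible q) (hh : G.Admissible h)
    (j : Fin n) : G.strategyInner (G.gradient j q p) h
      = G.eta j p * G.strategyInner G.discountedReturn h
        - G.α j * G.eta j p * G.strategyInner (fun t => G.cov *ᵥ p t) h
        - G.θ j * G.strategyInner (p - q) h := by
  rw [gradient, strategyInner_sub_left ((admissible_discountedReturn.smul _).sub
      ((hp.mulVec _).smul _)) ((hp.sub hq).smul _) hh,
    strategyInner_sub_left (admissible_discountedReturn.smul _) ((hp.mulVec _).smul _) hh]
  simp only [strategyInner_smul_left]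

theorem eta_add (hp : G.Admissible p) (hh : G.Admissible h) (j : Fin n) (ε : ℝ) :
    G.eta j (p + ε • h) = G.eta j p * Real.exp (
      ε * (-G.α j * G.strategyInner G.discountedReturn h
        + (G.α j) ^ 2 * G.strategyInner (fun t => G.cov *ᵥ p t) h)
      + ε ^ 2 * ((G.α j) ^ 2 / 2 * G.strategyInner (fun t => G.cov *ᵥ h t) h)) := by
  have hεh := hh.smul ε
  have h1 : G.strategyInner G.discountedReturn (p + ε • h)
      = G.strategyInner G.discountedReturn p + ε * G.strategyInner G.discountedReturn h := by
    rw [strategyInner_comm, strategyInner_add_left hp hεh admissible_discountedReturn,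
      strategyInner_smul_left, strategyInner_comm p, strategyInner_comm h]
  have h2 : (fun t => G.cov *ᵥ (p + ε • h) t)
      = (fun t => G.cov *ᵥ p t) + ε • fun t => G.cov *ᵥ h t := by
    ext1 t
    simp [Matrix.mulVec_add, Matrix.mulVec_smul]
  have h3 : ∀ a, G.Admissible a → G.strategyInner (fun t => G.cov *ᵥ a t) (p + ε • h)
      = G.strategyInner (fun t => G.cov *ᵥ a t) p
        + ε * G.strategyInner (fun t => G.cov *ᵥ a t) h := fun a ha => by
    rw [strategyInner_comm, strategyInner_add_left hp hεh (ha.mulVec _),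
      strategyInner_smul_left, strategyInner_comm p, strategyInner_comm h]
  rw [eta_eq, eta_eq, h1, h2, strategyInner_add_left (hp.mulVec _) ((hh.mulVec _).smul ε)
    (hp.add hεh), strategyInner_smul_left, h3 p hp, h3 h hh, strategyInner_cov_comm h p,
    ← Real.exp_add]
  congr 1
  ring

theorem deviation_add (hp : G.Admissible p) (hq : G.Admissible q) (hh : G.Admissible h) (ε : ℝ) :
    G.deviation (p + ε • h) q = G.deviation p q + ε * G.strategyInner (p - q) h
      + ε ^ 2 * (G.strategyInner h h / 2) := by
  have hdev : ∀ a, G.deviation a q = 1 / 2 * G.strategyInner (a - q) (a - q) := fun _ => rfl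
  have hεh := hh.smul ε
  have hpq := hp.sub hq
  rw [hdev, hdev, show p + ε • h - q = (p - q) + ε • h by abel,
    strategyInner_add_left hpq hεh (hpq.add hεh), strategyInner_comm (p - q),
    strategyInner_add_left hpq hεh hpq, strategyInner_smul_left, strategyInner_smul_left,
    strategyInner_comm h (p - q + ε • h), strategyInner_add_left hpq hεh hh,
    strategyInner_smul_left, strategyInner_comm h (p - q)]
  ring

theorem eta_pos (j : Fin n) (p : ℝ → Fin m → ℝ) : 0 < G.eta j p := Real.exp_pos _

/-- Supergradient inequality, that is, concavity: e^y ≥ 1 + y handles the utility, and the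
nonnegative quadratic terms in `h` are dropped. -/
theorem payoff_add_le (hp : G.Admissible p) (hq : G.Admissible q) (hh : G.Admissible h)
    (j : Fin n) : G.payoff j q (p + h) ≤ G.payoff j q p + G.strategyInner (G.gradient j q p) h := by
  have h1 := eta_add hp hh j 1
  have h2 := deviation_add hp hq hh 1
  rw [one_smul] at h1 h2
  rw [payoff, payoff, h1, h2, strategyInner_gradient hp hq hh]
  have hα := G.α_pos j
  have hα' := inv_pos.2 hα
  have hη := eta_pos (G := G) j p
  have hθ := G.θ_nonneg j
  have hA := strategyInner_cov_self_nonneg (G := G) h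
  have hN := strategyInner_self_nonneg (G := G) h
  set L := G.strategyInner G.discountedReturn h
  set Q := G.strategyInner (fun t => G.cov *ᵥ p t) h
  set S := G.strategyInner (fun t => G.cov *ᵥ h t) h
  set N := G.strategyInner h h
  set M := G.strategyInner (p - q) h
  have hexp : 1 + (-G.α j * L + G.α j ^ 2 * Q) ≤
      Real.exp (1 * (-G.α j * L + G.α j ^ 2 * Q) + 1 ^ 2 * (G.α j ^ 2 / 2 * S)) := by
    have h0 := Real.add_one_le_exp
      (1 * (-G.α j * L + G.α j ^ 2 * Q) + 1 ^ 2 * (G.α j ^ 2 / 2 * S))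
    have : 0 ≤ G.α j ^ 2 / 2 * S := by positivity
    linarith
  have h3 := mul_le_mul_of_nonneg_left hexp (mul_pos hα' hη).le
  have h4 : (G.α j)⁻¹ * G.eta j p * (1 + (-G.α j * L + G.α j ^ 2 * Q))
      = (G.α j)⁻¹ * G.eta j p - G.eta j p * L + G.α j * G.eta j p * Q := by
    field_simp
    ring
  have h5 : 0 ≤ G.θ j * N := mul_nonneg hθ hN
  rw [h4] at h3
  linarith

theorem hasDerivAt_payoff (hp : G.Admissible p) (hq : G.Admissible q) (hh : G.Admissible h)
    (j : Fin n) : HasDerivAt (fun ε : ℝ => G.payoff j q (p + ε • h))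
      (G.strategyInner (G.gradient j q p) h) 0 := by
  simp only [payoff, eta_add hp hh, deviation_add hp hq hh]
  rw [strategyInner_gradient hp hq hh]
  set L := G.strategyInner G.discountedReturn h
  set Q := G.strategyInner (fun t => G.cov *ᵥ p t) h
  set S := G.strategyInner (fun t => G.cov *ᵥ h t) h
  set N := G.strategyInner h h
  set M := G.strategyInner (p - q) h
  have hα := G.α_pos j
  have hlin : ∀ a b : ℝ, HasDerivAt (fun ε : ℝ => ε * a + ε ^ 2 * b) a 0 := fun a b => by
    have := ((hasDerivAt_id' (0 : ℝ)).mul_const a).fun_add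
      (((hasDerivAt_id' (0 : ℝ)).fun_pow 2).mul_const b)
    simpa using this
  have h1 := (hlin (-G.α j * L + G.α j ^ 2 * Q) (G.α j ^ 2 / 2 * S)).exp
  have h2 := ((h1.const_mul (G.eta j p)).const_mul (-(G.α j)⁻¹)).fun_sub
    (((hlin M (N / 2)).const_add (G.deviation p q)).const_mul (G.θ j))
  refine (h2.congr_deriv ?_).congr_of_eventuallyEq (Eventually.of_forall fun ε => ?_)
  · rw [zero_mul, zero_pow two_ne_zero, zero_mul, add_zero, Real.exp_zero]
    field_simp
    ring
  · ring

/-- The payoff is maximal exactly where its gradient vanishes. -/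
theorem payoff_le_iff (hp : G.Admissible p) (hq : G.Admissible q) (j : Fin n) :
    (∀ p', G.Admissible p' → G.payoff j q p' ≤ G.payoff j q p) ↔
      ∀ᵐ t ∂volume.restrict (Icc 0 G.T), G.gradient j q p t = 0 := by
  have hg := admissible_gradient hp hq j
  constructor
  · intro h
    -- The gradient itself is the test direction: the derivative along it is its squared norm, which
    -- must vanish at a maximum.
    refine ae_eq_zero_of_strategyInner_self hg ?_
    refine IsLocalMax.hasDerivAt_eq_zero (Eventually.of_forall fun ε => ?_)
      (hasDerivAt_payoff hp hq hg j)
    simp only [zero_smul, add_zero]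
    exact h _ (hp.add (hg.smul ε))
  · intro h p' hp'
    have := payoff_add_le hp hq (hp'.sub hp) j
    rwa [strategyInner_eq_zero_of_ae h, add_sub_cancel, add_zero] at this

end Variation

/-! ### Matrix form of the first-order condition -/

theorem isUnit_cov (G : InvestmentGame m n) : IsUnit G.cov :=
  G.σ_unit.mul ((Matrix.isUnit_transpose _).2 G.σ_unit)

theorem posDef_cov (G : InvestmentGame m n) : G.cov.PosDef := by
  have := Matrix.PosDef.mul_conjTranspose_self G.σ (Matrix.vecMul_injective_of_isUnit G.σ_unit)
  rwa [Matrix.conjTranspose_eq_transpose_of_trivial] at this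

theorem isUnit_opinionInv (G : InvestmentGame m n) (j : Fin n) (p : ℝ → Fin m → ℝ) :
    IsUnit (G.opinionInv j p) := by
  have hc : 0 ≤ (G.α j)⁻¹ * (G.eta j p)⁻¹ * G.θ j := by
    have := G.α_pos j
    have := eta_pos (G := G) j p
    have := G.θ_nonneg j
    positivity
  -- The influence coefficient may be 0, so the second summand is only semidefinite; the identity
  -- supplies definiteness.
  exact (Matrix.PosDef.one.add_posSemidef (G.posDef_cov.inv.posSemidef.smul hc)).isUnit

/-- With M = Z⁻¹, let w be the rational decision plus (M - 1)q - Mp. The gradient is αηΣw, and the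
difference of the two sides on the right is -Zw; Σ and Z are injective, so each vanishes iff w does.
-/
theorem gradient_eq_zero_iff (j : Fin n) (q p : ℝ → Fin m → ℝ) (t : ℝ) :
    G.gradient j q p t = 0 ↔
      p t = G.opinion j p *ᵥ G.rational j t + (1 - G.opinion j p) *ᵥ q t := by
  have hα := (G.α_pos j).ne'
  have hη := (eta_pos (G := G) j p).ne'
  have hM := (Matrix.isUnit_iff_isUnit_det _).1 (G.isUnit_opinionInv j p)
  have hS := (Matrix.isUnit_iff_isUnit_det _).1 G.isUnit_cov
  set M := G.opinionInv j p with hMdef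
  set c := (G.α j)⁻¹ * (G.eta j p)⁻¹ * G.θ j with hc
  have h1 : G.gradient j q p t = (G.α j * G.eta j p) • (G.cov *ᵥ
      (G.rational j t + (M - 1) *ᵥ q t - M *ᵥ p t)) := by
    have hMs : ∀ y, M *ᵥ y = y + c • (G.cov⁻¹ *ᵥ y) := fun y => by
      rw [hMdef, opinionInv, Matrix.add_mulVec, Matrix.one_mulVec, Matrix.smul_mulVec]
    have hcc : ∀ y, G.cov *ᵥ (G.cov⁻¹ *ᵥ y) = y := fun y => by
      rw [Matrix.mulVec_mulVec, Matrix.mul_nonsing_inv _ hS, Matrix.one_mulVec]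
    rw [Matrix.sub_mulVec, Matrix.one_mulVec, hMs, hMs, rational]
    simp only [Matrix.mulVec_sub, Matrix.mulVec_add, Matrix.mulVec_smul, hcc]
    simp only [gradient, discountedReturn, Pi.sub_apply, Pi.smul_apply]
    ext i
    simp only [Pi.sub_apply, Pi.smul_apply, Pi.add_apply, smul_eq_mul, hc]
    field_simp
    ring
  have h2 : p t - (G.opinion j p *ᵥ G.rational j t + (1 - G.opinion j p) *ᵥ q t)
      = -(M⁻¹ *ᵥ (G.rational j t + (M - 1) *ᵥ q t - M *ᵥ p t)) := by
    have hinv : ∀ y, M⁻¹ *ᵥ (M *ᵥ y) = y := fun y => by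
      rw [Matrix.mulVec_mulVec, Matrix.nonsing_inv_mul _ hM, Matrix.one_mulVec]
    rw [opinion, ← hMdef, Matrix.mulVec_sub, Matrix.mulVec_add, Matrix.sub_mulVec,
      Matrix.sub_mulVec, Matrix.mulVec_sub, hinv, hinv]
    simp only [Matrix.one_mulVec]
    abel
  rw [← sub_eq_zero (a := p t), h2, h1, neg_eq_zero, smul_eq_zero_iff_right (mul_ne_zero hα hη)]
  have hinj1 : Function.Injective (G.cov *ᵥ ·) := Matrix.mulVec_injective_of_isUnit G.isUnit_cov
  have hinj2 : Function.Injective (M⁻¹ *ᵥ ·) := Matrix.mulVec_injective_of_isUnit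
    ((Matrix.isUnit_nonsing_inv_iff).2 (G.isUnit_opinionInv j p))
  rw [hinj1.eq_iff' (Matrix.mulVec_zero _), hinj2.eq_iff' (Matrix.mulVec_zero _)]

end InvestmentGame

theorem theorem1 {Ω : Type*} [MeasurableSpace Ω] (μ : Measure Ω) [IsProbabilityMeasure μ]
    {m n : ℕ} (B : Fin m → ℝ≥0 → Ω → ℝ) (hB : IsStandardBrownian B μ)
    (G : InvestmentGame m n) (P : Fin n → ℝ → Fin m → ℝ) (hP : ∀ j, G.Admissible (P j)) :
    (∀ j, IsUnit (G.opinionInv j (P j))) ∧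
    (G.IsOptimalProfile B μ P ↔
      ∀ j, ∀ᵐ t ∂(volume.restrict (Icc 0 G.T)),
        P j t = G.opinion j (P j) *ᵥ G.rational j t
          + (1 - G.opinion j (P j)) *ᵥ G.followees P j t) := by
  -- Each agent's problem holds the followees' average fixed, so the equivalence holds agent by
  -- agent. Both sides use the same given profile, so the dependence of η on it calls for no
  -- fixed-point argument.
  refine ⟨fun j => G.isUnit_opinionInv j (P j), forall_congr' fun j => ?_⟩
  rw [InvestmentGame.isOptimalAgainst_iff hB (hP j),
    InvestmentGame.payoff_le_iff (hP j) (InvestmentGame.admissible_followees hP j)]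
  simp only [InvestmentGame.gradient_eq_zero_iff]
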